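/- Let $0<q<1$, $\mu\in\mathbb C$, $\kappa=-\dfrac{2\pi}{\ln q}>0$, and $\mu_k=\mu+k\kappa i$ for $k\in\mathbb Z$, and write $q^\mu=e^{\mu\ln q}$. For $a\in\mathbb C$ put $(a)_n=\prod_{j=0}^{n-1}(a+j)$, $(a;q)_n=\prod_{j=0}^{n-1}(1-aq^j)$, $(a;q)_\infty=\prod_{j\ge 0}(1-aq^j)$, and define the entire functions $$F(\mu;q,x)=\sum_{n\ge0}\frac{(q^\mu;q)_n}{n!}(-x)^n,\qquad G(a;q,x)=\sum_{n\ge0}\frac{(a)_n\,q^{n(n+1)/2}}{(q;q)_n}(-x)^n .$$ (1) The function $x\mapsto F(\mu;q,x)$ on $\mathbb C$ and, for every $k\in\mathbb Z$, the function $x\mapsto x^{-\mu_k}\,G(\mu_k;q,\tfrac1x)$ on the Riemann surface of the logarithm (where $x^{a}=e^{a\log x}$ and $qx$ has the same argument as $x$) satisfy $$y'(x)=q^\mu\,y(qx)-y(x).$$ (2) If moreover $\mu\notin\mathbb Z_{\le0}\oplus\kappa\mathbb Z i$ (that is, $\mu\neq -m+\kappa l i$ for all integers $m\ge0$ and $l$),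 then for every $x\in\mathbb C$ with $\operatorname{Re}x>0$ $$F(\mu;q,x)=\frac{\kappa\,(q^\mu;q)_\infty}{2\pi\,(q;q)_\infty}\sum_{k\in\mathbb Z}\Gamma(\mu_k)\,x^{-\mu_k}\,G(\mu_k;q,\tfrac1x),$$ where $\Gamma$ is the Euler Gamma function, $x^{-\mu_k}$ is the principal power, and the series over $k\in\mathbb Z$ converges absolutely. -/

import Mathlib

open Filter Topology

noncomputable section

namespace Pantograph

/-! ### `q`-shifted factorials and the constants `κ`, `μ_k` -/

/-- The finite `q`-shifted factorial `(a;q)_n = ∏_{j<n} (1 - a q^j)`. -/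
def qPoch (a : ℂ) (q : ℝ) (n : ℕ) : ℂ := ∏ j ∈ Finset.range n, (1 - a * (q : ℂ) ^ j)

/-- The infinite `q`-shifted factorial `(a;q)_∞ = ∏_{j≥0} (1 - a q^j)`; it converges for
`0 < q < 1`, see `tendsto_qPoch`. -/
def qPochInf (a : ℂ) (q : ℝ) : ℂ := ∏' j : ℕ, (1 - a * (q : ℂ) ^ j)

/-- The number `κ = -2π / ln q`. -/
def kappa (q : ℝ) : ℝ := -(2 * Real.pi) / Real.log q

/-- The exponents `μ_k = μ + k κ i`. -/
def muK (q : ℝ) (μ : ℂ) (k : ℤ) : ℂ := μ + (k : ℂ) * (kappa q : ℂ) * Complex.I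

/-! ### The two power series -/

/-- `F(μ;q,x) = ∑_{n≥0} (q^μ;q)_n (-x)^n / n!`. -/
def F (μ : ℂ) (q : ℝ) (x : ℂ) : ℂ :=
  ∑' n : ℕ, qPoch ((q : ℂ) ^ μ) q n / (n.factorial : ℂ) * (-x) ^ n

/-- `G(a;q,x) = ∑_{n≥0} (a)_n q^{n(n+1)/2} (-x)^n / (q;q)_n`, where
`(a)_n = a (a+1) ⋯ (a+n-1)`. -/
def G (a : ℂ) (q : ℝ) (x : ℂ) : ℂ :=
  ∑' n : ℕ, (ascPochhammer ℂ n).eval a * (q : ℂ) ^ (n * (n + 1) / 2) / qPoch (q : ℂ) q n * (-x) ^ n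

/-! ### The Riemann surface of the logarithm -/

/-- The Riemann surface of the logarithm, as the set `]0,∞[ × ℝ` of pairs (modulus, argument). -/
structure LogSurface where
  abs : ℝ
  arg : ℝ
  abs_pos : 0 < abs

namespace LogSurface

/-- The logarithm, a globally defined bijection of the surface onto `ℂ`. -/
def log (p : LogSurface) : ℂ := (Real.log p.abs : ℂ) + (p.arg : ℂ) * Complex.I

/-- The point of the surface with a given logarithm. -/
def ofLog (w : ℂ) : LogSurface := ⟨Real.exp w.re, w.im, Real.exp_pos _⟩

/-- The covering map onto `ℂ \ {0}`. -/
def proj (p : LogSurface) : ℂ := (p.abs : ℂ) * Complex.exp ((p.arg : ℂ) * Complex.I)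

/-- The power `x^a = e^{a log x}`. -/
def pow (p : LogSurface) (a : ℂ) : ℂ := Complex.exp (a * p.log)

/-- Multiplication by a positive real number (the argument does not change). -/
def scale (r : ℝ) (hr : 0 < r) (p : LogSurface) : LogSurface :=
  ⟨r * p.abs, p.arg, mul_pos hr p.abs_pos⟩

/-- The local inverse of the covering map `proj` around the point `p`: for `z` near `proj p`, the
point over `z` on the same sheet as `p`. (For `z ≠ 0` it is the point over `z` whose argument is
in `]arg p - π, arg p + π]`; only `z` close to `proj p` matter.) -/
def sheet (p : LogSurface) (z : ℂ) : LogSurface := ofLog (p.log + Complex.log (z / p.proj))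

/-- `y` has the complex derivative `d` at the point `p`, with respect to the variable `x ∈ ℂ`
(the local coordinate `proj`). -/
def HasDeriv (y : LogSurface → ℂ) (d : ℂ) (p : LogSurface) : Prop :=
  HasDerivAt (fun z : ℂ => y (p.sheet z)) d p.proj

theorem exp_log (p : LogSurface) : Complex.exp p.log = p.proj := by
  rw [log, proj, Complex.exp_add, ← Complex.ofReal_exp, Real.exp_log p.abs_pos]

theorem proj_ne_zero (p : LogSurface) : p.proj ≠ 0 := by
  rw [← exp_log]; exact Complex.exp_ne_zero _

theorem log_ofLog (w : ℂ) : (ofLog w).log = w := by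
  simp [log, ofLog]

theorem ofLog_log (p : LogSurface) : ofLog p.log = p := by
  cases p with
  | mk r t h => simp [log, ofLog, Real.exp_log h]

theorem proj_sheet (p : LogSurface) (z : ℂ) (hz : z ≠ 0) : (p.sheet z).proj = z := by
  rw [← exp_log, sheet, log_ofLog, Complex.exp_add, exp_log,
    Complex.exp_log (div_ne_zero hz p.proj_ne_zero), mul_div_cancel₀ _ p.proj_ne_zero]

theorem sheet_proj (p : LogSurface) : p.sheet p.proj = p := by
  rw [sheet, div_self p.proj_ne_zero, Complex.log_one, add_zero, ofLog_log]

end LogSurface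

/-- The function `x ↦ x^{-a} G(a;q,1/x)` on the Riemann surface of the logarithm. -/
def solInfinity (a : ℂ) (q : ℝ) (x : LogSurface) : ℂ := x.pow (-a) * G a q (1 / x.proj)

/-- On the slit plane, identified with the sheet `-π < arg x < π`, the power in `solInfinity` is the
principal one. -/
theorem solInfinity_ofLog_log (a : ℂ) (q : ℝ) {x : ℂ} (hx : x ≠ 0) :
    solInfinity a q (LogSurface.ofLog (Complex.log x)) = x ^ (-a) * G a q (1 / x) := by
  rw [solInfinity, LogSurface.pow, ← LogSurface.exp_log, LogSurface.log_ofLog, Complex.exp_log hx,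
    Complex.cpow_def_of_ne_zero hx, mul_comm (-a)]

/-! ### The infinite product and the two series converge -/

theorem tendsto_qpow {q : ℝ} (h0 : 0 < q) (h1 : q < 1) :
    Tendsto (fun n : ℕ => (q : ℂ) ^ n) atTop (𝓝 0) := by
  apply tendsto_pow_atTop_nhds_zero_of_norm_lt_one
  simpa [abs_of_pos h0] using h1

theorem tendsto_qPoch {q : ℝ} (h0 : 0 < q) (h1 : q < 1) (a : ℂ) :
    Tendsto (qPoch a q) atTop (𝓝 (qPochInf a q)) := by
  have hs : Summable (fun j : ℕ => ‖-(a * (q : ℂ) ^ j)‖) := by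
    simp only [norm_neg, norm_mul, norm_pow, Complex.norm_real, Real.norm_eq_abs, abs_of_pos h0]
    exact (summable_geometric_of_lt_one h0.le h1).mul_left _
  have hm := multipliable_one_add_of_summable hs
  simp only [← sub_eq_add_neg] at hm
  exact hm.hasProd.tendsto_prod_nat

theorem summable_of_ratio_tendsto_zero {f c : ℕ → ℂ} (h : ∀ n, f (n + 1) = c n * f n)
    (hc : Tendsto c atTop (𝓝 0)) : Summable f := by
  have h2 : ∀ᶠ n in atTop, ‖c n‖ < 1 / 2 := by
    have := hc.norm
    rw [norm_zero] at this
    exact this.eventually_lt_const (by norm_num)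
  refine summable_of_ratio_norm_eventually_le (r := 1 / 2) (by norm_num) ?_
  filter_upwards [h2] with n hn
  rw [h, norm_mul]
  exact mul_le_mul_of_nonneg_right hn.le (norm_nonneg _)

theorem summable_F {q : ℝ} (h0 : 0 < q) (h1 : q < 1) (μ x : ℂ) :
    Summable (fun n : ℕ => qPoch ((q : ℂ) ^ μ) q n / (n.factorial : ℂ) * (-x) ^ n) := by
  refine summable_of_ratio_tendsto_zero
    (c := fun n => (1 - (q : ℂ) ^ μ * (q : ℂ) ^ n) * (-x) * (1 / ((n : ℂ) + 1))) ?_ ?_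
  · intro n
    have h2 : ((n : ℂ) + 1) ≠ 0 := by exact_mod_cast Nat.succ_ne_zero n
    have h3 : (n.factorial : ℂ) ≠ 0 := by exact_mod_cast Nat.factorial_ne_zero n
    rw [qPoch, Finset.prod_range_succ, ← qPoch, Nat.factorial_succ]
    push_cast
    field_simp
    ring
  · have h2 := ((tendsto_qpow h0 h1).const_mul ((q : ℂ) ^ μ)).const_sub 1
    simpa using (h2.mul_const (-x)).mul (tendsto_one_div_add_atTop_nhds_zero_nat (𝕜 := ℂ))

theorem one_sub_qpow_ne_zero {q : ℝ} (h0 : 0 < q) (h1 : q < 1) (n : ℕ) :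
    1 - (q : ℂ) * (q : ℂ) ^ n ≠ 0 := by
  have h2 : q * q ^ n < 1 := by
    rw [← pow_succ']
    exact pow_lt_one₀ h0.le h1 (Nat.succ_ne_zero n)
  have h3 : (1 - q * q ^ n : ℝ) ≠ 0 := by linarith
  exact_mod_cast h3

theorem summable_G {q : ℝ} (h0 : 0 < q) (h1 : q < 1) (a x : ℂ) :
    Summable (fun n : ℕ => (ascPochhammer ℂ n).eval a * (q : ℂ) ^ (n * (n + 1) / 2)
      / qPoch (q : ℂ) q n * (-x) ^ n) := by
  refine summable_of_ratio_tendsto_zero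
    (c := fun n => (a * (q : ℂ) ^ n + (n : ℂ) * (q : ℂ) ^ n) * (q : ℂ) * (-x)
      * (1 - (q : ℂ) * (q : ℂ) ^ n)⁻¹) ?_ ?_
  · intro n
    have h2 := one_sub_qpow_ne_zero h0 h1 n
    have h3 : qPoch (q : ℂ) q n ≠ 0 :=
      Finset.prod_ne_zero_iff.mpr fun j _ => one_sub_qpow_ne_zero h0 h1 j
    have h4 : (n + 1) * (n + 1 + 1) / 2 = n * (n + 1) / 2 + (n + 1) := by
      rw [show (n + 1) * (n + 1 + 1) = n * (n + 1) + (n + 1) * 2 by ring,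
        Nat.add_mul_div_right _ _ (by norm_num)]
    rw [h4, ascPochhammer_succ_eval, pow_add,
      show qPoch (q : ℂ) q (n + 1) = qPoch (q : ℂ) q n * (1 - (q : ℂ) * (q : ℂ) ^ n) from
        Finset.prod_range_succ _ _]
    field_simp
    ring
  · have h2 := tendsto_qpow h0 h1
    have h3 : Tendsto (fun n : ℕ => (n : ℂ) * (q : ℂ) ^ n) atTop (𝓝 0) := by
      have h := tendsto_self_mul_const_pow_of_lt_one h0.le h1
      have h' := (Complex.continuous_ofReal.tendsto 0).comp h
      simpa [Function.comp_def] using h'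
    have h4 : Tendsto (fun n : ℕ => (1 - (q : ℂ) * (q : ℂ) ^ n)⁻¹) atTop (𝓝 1) := by
      have h := (h2.const_mul (q : ℂ)).const_sub 1
      rw [mul_zero, sub_zero] at h
      simpa using h.inv₀ one_ne_zero
    simpa using ((((h2.const_mul a).add h3).mul_const (q : ℂ)).mul_const (-x)).mul h4

end Pantograph

end

noncomputable section

namespace Pantograph

/-! ### Derivatives of everywhere convergent power series -/

/-! Part (1) splits into contiguous relations. Differentiation and the `q`-difference `y(x) - q^μ
y(qx)` both turn `F(μ)` into a multiple of `F(μ+1)`, with the same factor up to sign; the same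
happens to `x^{-a} G(a;q,1/x)` when `q^a = q^μ`, and `κ` is chosen so that this holds for every `a =
μ_k` (`qpow_muK`).

For part (2), let first `Re μ > 0`. Euler's expansion of `1/(z;q)_∞` gives `F = (q^μ;q)_∞ ∑_{j≥0}
q^{μj} e^{-xq^j} / (q;q)_j` (`F_eq_tsum_exp`). Since `1/(q;q)_j = (q^{j+1};q)_∞ / (q;q)_∞` and
`(q^{j+1};q)_∞` vanishes for `j < 0`, the sum may run over all integers. Expanding `(q^{j+1};q)_∞`
by Euler's other formula leaves bilateral sums `∑_j q^{(μ+m)j} e^{-xq^j}`, which Poisson summation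
turns into `(κ/2π) ∑_k Γ(μ_k+m) x^{-μ_k-m}` (`tsum_zpow_mul_exp`). Summing over `m` rebuilds
`G(μ_k;q,1/x)`. The interchanges rest on the decay of `Γ(s) x^{-s}` in `Im s`, uniform on truncated
half-discs (`exists_norm_Gamma_mul_cpow_neg_le`).

The other `μ` are reached by descent from `μ+1` to `μ`. The contiguous relations transfer normal
convergence (`ConnNormal.of_add_one`) and then the identity (`F_eq_tsum_connTerm_of_add_one`); both
steps need `q^μ ≠ 1`, which the exclusion of the poles guarantees. -/

theorem summable_norm_mul_pow {c : ℕ → ℂ} (hc : ∀ z : ℂ, Summable fun n => c n * z ^ n) {R : ℝ}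
    (hR : 0 ≤ R) : Summable fun n => ‖c n‖ * R ^ n := by
  have h := (hc (R : ℂ)).norm
  simpa [abs_of_nonneg hR] using h

/-- The factor `n ≤ 2^n` is absorbed by doubling the radius; `R ≥ 1` lets `R^(n-1)` be replaced by
`R^n`, also at `n = 0`. -/
theorem summable_norm_mul_deriv_pow {c : ℕ → ℂ} (hc : ∀ z : ℂ, Summable fun n => c n * z ^ n)
    {R : ℝ} (hR : 1 ≤ R) : Summable fun n : ℕ => ‖c n‖ * (n * R ^ (n - 1)) := by
  have hR0 : 0 ≤ R := by linarith
  refine Summable.of_nonneg_of_le (fun n => by positivity) (fun n => ?_)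
    (summable_norm_mul_pow hc (R := 2 * R) (by positivity))
  rw [mul_pow]
  gcongr
  · exact_mod_cast n.lt_two_pow_self.le
  · omega

theorem summable_mul_deriv_pow {c : ℕ → ℂ} (hc : ∀ z : ℂ, Summable fun n => c n * z ^ n) (z : ℂ) :
    Summable fun n : ℕ => c n * (n * z ^ (n - 1)) := by
  refine Summable.of_norm_bounded
    (summable_norm_mul_deriv_pow hc (R := ‖z‖ + 1) (by simp)) (fun n => ?_)
  simp only [norm_mul, norm_pow, Complex.norm_natCast]
  gcongr
  linarith

theorem hasDerivAt_tsum_mul_pow {c : ℕ → ℂ} (hc : ∀ z : ℂ, Summable fun n => c n * z ^ n) (z : ℂ) :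
    HasDerivAt (fun z => ∑' n, c n * z ^ n) (∑' n : ℕ, c n * (n * z ^ (n - 1))) z := by
  refine hasDerivAt_tsum_of_isPreconnected
    (summable_norm_mul_deriv_pow hc (R := ‖z‖ + 1) (by simp))
    (t := Metric.ball 0 (‖z‖ + 1)) Metric.isOpen_ball (convex_ball _ _).isPreconnected
    (fun n y _ => (hasDerivAt_pow n y).const_mul (c n)) (fun n y hy => ?_)
    (y₀ := z) (by simp) (hc z) (by simp)
  simp only [norm_mul, norm_pow, Complex.norm_natCast]
  gcongr
  simpa using (mem_ball_zero_iff.mp hy).le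

/-! ### The pantograph equation for `F` -/

theorem qPoch_succ (a : ℂ) (q : ℝ) (n : ℕ) :
    qPoch a q (n + 1) = qPoch a q n * (1 - a * (q : ℂ) ^ n) :=
  Finset.prod_range_succ _ _

theorem qPoch_succ_left (a : ℂ) (q : ℝ) (n : ℕ) :
    qPoch a q (n + 1) = (1 - a) * qPoch (a * q) q n := by
  simp only [qPoch, Finset.prod_range_succ']
  rw [mul_comm, pow_zero, mul_one]
  congr 1
  exact Finset.prod_congr rfl fun j _ => by ring

theorem qpow_add_one {q : ℝ} (h0 : 0 < q) (μ : ℂ) : (q : ℂ) ^ (μ + 1) = (q : ℂ) ^ μ * q := by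
  rw [Complex.cpow_add _ _ (by exact_mod_cast h0.ne'), Complex.cpow_one]

theorem hasDerivAt_F_shift {q : ℝ} (h0 : 0 < q) (h1 : q < 1) (μ x : ℂ) :
    HasDerivAt (F μ q) (-(1 - (q : ℂ) ^ μ) * F (μ + 1) q x) x := by
  have hs := fun z => by simpa using summable_F h0 h1 μ (-z)
  have h := (hasDerivAt_tsum_mul_pow hs (-x)).scomp x (hasDerivAt_neg x)
  refine h.congr_deriv ?_
  rw [(summable_mul_deriv_pow hs (-x)).tsum_eq_zero_add, F, ← tsum_mul_left]
  simp only [Nat.cast_zero, zero_mul, mul_zero, zero_add, smul_eq_mul, ← tsum_mul_left]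
  refine tsum_congr fun n => ?_
  rw [qPoch_succ_left, qpow_add_one h0, Nat.factorial_succ]
  have h2 : ((n : ℂ) + 1) ≠ 0 := by exact_mod_cast Nat.succ_ne_zero n
  have h3 : (n.factorial : ℂ) ≠ 0 := by exact_mod_cast Nat.factorial_ne_zero n
  push_cast
  field_simp

/-- The `n`-th coefficient acquires the factor `1 - q^μ q^n`, which extends `(q^μ;q)_n` to
`(q^μ;q)_{n+1}`; splitting off the first factor instead of the last gives the coefficient for `μ+1`.
-/
theorem F_sub_F_scale {q : ℝ} (h0 : 0 < q) (h1 : q < 1) (μ x : ℂ) :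
    F μ q x - (q : ℂ) ^ μ * F μ q (q * x) = (1 - (q : ℂ) ^ μ) * F (μ + 1) q x := by
  simp only [F]
  rw [← tsum_mul_left, ← tsum_mul_left, ← (summable_F h0 h1 μ x).tsum_sub
    ((summable_F h0 h1 μ (q * x)).mul_left _)]
  refine tsum_congr fun n => ?_
  have h := (qPoch_succ ((q : ℂ) ^ μ) q n).symm.trans (qPoch_succ_left _ q n)
  rw [qpow_add_one h0]
  linear_combination (-x) ^ n / (n.factorial : ℂ) * h

theorem hasDerivAt_F {q : ℝ} (h0 : 0 < q) (h1 : q < 1) (μ x : ℂ) :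
    HasDerivAt (F μ q) ((q : ℂ) ^ μ * F μ q ((q : ℂ) * x) - F μ q x) x :=
  (hasDerivAt_F_shift h0 h1 μ x).congr_deriv (by linear_combination F_sub_F_scale h0 h1 μ x)

/-! ### The pantograph equation at infinity -/

theorem qPoch_self_ne_zero {q : ℝ} (h0 : 0 < q) (h1 : q < 1) (n : ℕ) : qPoch (q : ℂ) q n ≠ 0 :=
  Finset.prod_ne_zero_iff.mpr fun j _ => one_sub_qpow_ne_zero h0 h1 j

theorem triangle_succ (n : ℕ) : (n + 1) * (n + 1 + 1) / 2 = n * (n + 1) / 2 + (n + 1) := by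
  rw [show (n + 1) * (n + 1 + 1) = n * (n + 1) + (n + 1) * 2 by ring,
    Nat.add_mul_div_right _ _ (by norm_num)]

theorem ascPochhammer_eval_mul (a : ℂ) (n : ℕ) :
    (a + n) * (ascPochhammer ℂ n).eval a = a * (ascPochhammer ℂ n).eval (a + 1) := by
  have h1 : (ascPochhammer ℂ (n + 1)).eval a = a * (ascPochhammer ℂ n).eval (a + 1) := by
    rw [ascPochhammer_succ_left]; simp
  rw [← h1, ascPochhammer_succ_eval, mul_comm]

/-- The factor `q^{-n} - 1` kills the constant term and cancels the last factor of `(q;q)_n`, so the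
series shifts by one index. -/
theorem G_scale_sub_G {q : ℝ} (h0 : 0 < q) (h1 : q < 1) (a w : ℂ) :
    G a q (w / q) - G a q w = -a * w * G (a + 1) q w := by
  have hq : (q : ℂ) ≠ 0 := by exact_mod_cast h0.ne'
  simp only [G]
  rw [← (summable_G h0 h1 a (w / q)).tsum_sub (summable_G h0 h1 a w),
    ((summable_G h0 h1 a (w / q)).sub (summable_G h0 h1 a w)).tsum_eq_zero_add, ← tsum_mul_left]
  simp only [pow_zero, sub_self, zero_add]
  refine tsum_congr fun n => ?_
  have h2 := qPoch_self_ne_zero h0 h1 n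
  have h3 := one_sub_qpow_ne_zero h0 h1 n
  rw [triangle_succ, qPoch_succ, ascPochhammer_succ_eval, pow_add, ← neg_div, div_pow,
    mul_comm _ (a + n), ascPochhammer_eval_mul]
  field_simp
  ring

/-- The operator `a + w d/dw` multiplies the `n`-th coefficient by `a + n`, and `(a+n)(a)_n = a
(a+1)_n`. -/
theorem hasDerivAt_G {q : ℝ} (h0 : 0 < q) (h1 : q < 1) (a w : ℂ) :
    ∃ d, HasDerivAt (G a q) d w ∧ a * G a q w + w * d = a * G (a + 1) q w := by
  have hs := fun z => by simpa using summable_G h0 h1 a (-z)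
  have h := (hasDerivAt_tsum_mul_pow hs (-w)).scomp w (hasDerivAt_neg w)
  refine ⟨_, h, ?_⟩
  have hs' := summable_mul_deriv_pow hs (-w)
  simp only [G, smul_eq_mul, ← mul_assoc]
  rw [← tsum_mul_left, ← tsum_mul_left, ← tsum_mul_left,
    ← ((summable_G h0 h1 a w).mul_left a).tsum_add (by simpa [mul_assoc] using hs'.mul_left (w * -1))]
  refine tsum_congr fun n => ?_
  have h4 := ascPochhammer_eval_mul a n
  have h5 : (w * -1) * (n * (-w) ^ (n - 1)) = n * (-w) ^ n := by
    cases n with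
    | zero => simp
    | succ n => rw [Nat.add_sub_cancel]; ring
  linear_combination (q : ℂ) ^ (n * (n + 1) / 2) / qPoch (q : ℂ) q n * (-w) ^ n * h4
    + (ascPochhammer ℂ n).eval a * (q : ℂ) ^ (n * (n + 1) / 2) / qPoch (q : ℂ) q n * h5

/-- Differentiation of `x^{-a} G(a;q,1/x)` with respect to any branch `ℓ` of the logarithm. -/
theorem hasDerivAt_exp_mul_G {q : ℝ} (h0 : 0 < q) (h1 : q < 1) (a : ℂ) {l : ℂ → ℂ} {x : ℂ}
    (hx : x ≠ 0) (hl : HasDerivAt l x⁻¹ x) :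
    HasDerivAt (fun z => Complex.exp (-a * l z) * G a q (1 / z))
      (-a * x⁻¹ * Complex.exp (-a * l x) * G (a + 1) q (1 / x)) x := by
  obtain ⟨d, hd, he⟩ := hasDerivAt_G h0 h1 a (1 / x)
  have hi : HasDerivAt (fun z : ℂ => 1 / z) (-(x ^ 2)⁻¹) x := by
    simpa [one_div] using hasDerivAt_inv hx
  refine ((hl.const_mul (-a)).cexp.mul (hd.comp x hi)).congr_deriv ?_
  simp only [Function.comp_def]
  have : (x ^ 2)⁻¹ = x⁻¹ * x⁻¹ := by rw [sq, mul_inv]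
  rw [this]
  rw [one_div] at he ⊢
  linear_combination (-x⁻¹ * Complex.exp (-a * l x)) * he

theorem qpow_muK {q : ℝ} (h0 : 0 < q) (h1 : q < 1) (μ : ℂ) (k : ℤ) :
    (q : ℂ) ^ muK q μ k = (q : ℂ) ^ μ := by
  have hq : (q : ℂ) ≠ 0 := by exact_mod_cast h0.ne'
  have hl : (Real.log q : ℂ) ≠ 0 := by exact_mod_cast (Real.log_neg h0 h1).ne
  rw [Complex.cpow_def_of_ne_zero hq, Complex.cpow_def_of_ne_zero hq, Complex.exp_eq_exp_iff_exists_int]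
  refine ⟨-k, ?_⟩
  rw [← Complex.ofReal_log h0.le, muK, kappa]
  push_cast
  field_simp

/-- The two expressions for the derivative of `x^{-a} G(a;q,1/x)` agree. -/
theorem exp_mul_G_scale_sub {q : ℝ} (h0 : 0 < q) (h1 : q < 1) {μ : ℂ} {k : ℤ} (l x : ℂ) :
    (q : ℂ) ^ μ * (Complex.exp (-muK q μ k * (Real.log q + l)) * G (muK q μ k) q (1 / (q * x)))
      - Complex.exp (-muK q μ k * l) * G (muK q μ k) q (1 / x)
      = -muK q μ k * x⁻¹ * Complex.exp (-muK q μ k * l) * G (muK q μ k + 1) q (1 / x) := by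
  have hq : (q : ℂ) ≠ 0 := by exact_mod_cast h0.ne'
  have h := G_scale_sub_G h0 h1 (muK q μ k) (1 / x)
  rw [← qpow_muK h0 h1 μ k, Complex.cpow_def_of_ne_zero hq, ← Complex.ofReal_log h0.le, mul_add,
    Complex.exp_add, show 1 / ((q : ℂ) * x) = 1 / x / q by rw [div_div, mul_comm]]
  have h2 : Complex.exp ((Real.log q : ℂ) * muK q μ k) * Complex.exp (-muK q μ k * Real.log q) = 1 := by
    rw [← Complex.exp_add]
    simp [mul_comm]
  rw [one_div] at h ⊢
  linear_combination Complex.exp (-muK q μ k * l) * h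
    + Complex.exp (-muK q μ k * l) * G (muK q μ k) q (x⁻¹ / q) * h2

theorem hasDeriv_solInfinity {q : ℝ} (h0 : 0 < q) (h1 : q < 1) (μ : ℂ) (k : ℤ) (x : LogSurface) :
    LogSurface.HasDeriv (solInfinity (muK q μ k) q)
        ((q : ℂ) ^ μ * solInfinity (muK q μ k) q (x.scale q h0)
          - solInfinity (muK q μ k) q x) x := by
  have hx := x.proj_ne_zero
  -- In the local coordinate the sheet through `x` is a branch of the logarithm, a translate of the
  -- principal one near `1`.
  have hl : HasDerivAt (fun z => x.log + Complex.log (z / x.proj)) x.proj⁻¹ x.proj := by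
    have h := ((hasDerivAt_id x.proj).div_const x.proj).clog (by simp [hx])
    simpa [hx] using h.const_add x.log
  have h := hasDerivAt_exp_mul_G h0 h1 (muK q μ k) hx hl
  have hsl : (x.scale q h0).log = Real.log q + x.log := by
    simp only [LogSurface.log, LogSurface.scale, Real.log_mul h0.ne' x.abs_pos.ne']
    push_cast
    ring
  have hsp : (x.scale q h0).proj = q * x.proj := by
    simp only [LogSurface.proj, LogSurface.scale]
    push_cast
    ring
  simp only [LogSurface.HasDeriv, solInfinity, LogSurface.pow]
  rw [hsl, hsp, exp_mul_G_scale_sub h0 h1]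
  simp only [div_self hx, Complex.log_one, add_zero] at h
  refine h.congr_of_eventuallyEq ?_
  filter_upwards [isOpen_ne.mem_nhds hx] with z hz
  rw [LogSurface.proj_sheet _ _ hz, LogSurface.sheet, LogSurface.log_ofLog]

/-! ### Euler's two expansions -/

theorem qPoch_mul_eq_of_functional_eq {q : ℝ} {f : ℂ → ℂ} (z : ℂ)
    (hf : ∀ n : ℕ, f (z * (q : ℂ) ^ n) = (1 - z * (q : ℂ) ^ n) * f (z * (q : ℂ) ^ (n + 1)))
    (n : ℕ) : f z = qPoch z q n * f (z * (q : ℂ) ^ n) := by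
  induction n with
  | zero => simp [qPoch]
  | succ n ih => rw [ih, hf n, qPoch_succ, mul_assoc]

/-- Iterating the functional equation leaves the remainder `f(z q^n)`, which tends to `f 0 = 1`. -/
theorem qPochInf_eq_of_functional_eq {q : ℝ} (h0 : 0 < q) (h1 : q < 1) {f : ℂ → ℂ} (z : ℂ)
    (hf : ∀ n : ℕ, f (z * (q : ℂ) ^ n) = (1 - z * (q : ℂ) ^ n) * f (z * (q : ℂ) ^ (n + 1)))
    (hc : ContinuousAt f 0) (hf0 : f 0 = 1) : qPochInf z q = f z := by
  have h2 : Tendsto (fun n : ℕ => z * (q : ℂ) ^ n) atTop (𝓝 0) := by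
    simpa using (tendsto_qpow h0 h1).const_mul z
  have h3 := (tendsto_qPoch h0 h1 z).mul (hc.tendsto.comp h2)
  simp only [hf0, mul_one] at h3
  refine tendsto_nhds_unique h3 (tendsto_const_nhds.congr fun n => ?_)
  exact qPoch_mul_eq_of_functional_eq z hf n

/-- The coefficients `(-1)^m q^{m(m+1)/2} / (q;q)_m` of `(qz;q)_∞`. -/
def eulerCoeff (q : ℝ) (m : ℕ) : ℂ := (-1) ^ m * (q : ℂ) ^ (m * (m + 1) / 2) / qPoch (q : ℂ) q m

theorem summable_eulerCoeff {q : ℝ} (h0 : 0 < q) (h1 : q < 1) (z : ℂ) :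
    Summable fun m => eulerCoeff q m * z ^ m := by
  refine summable_of_ratio_tendsto_zero
    (c := fun n => (q : ℂ) ^ n * ((q : ℂ) * (-z)) * (1 - (q : ℂ) * (q : ℂ) ^ n)⁻¹) ?_ ?_
  · intro n
    have h2 := one_sub_qpow_ne_zero h0 h1 n
    have h3 := qPoch_self_ne_zero h0 h1 n
    rw [eulerCoeff, eulerCoeff, triangle_succ, qPoch_succ, pow_add]
    field_simp
    ring
  · have h2 := tendsto_qpow h0 h1
    have h4 : Tendsto (fun n : ℕ => (1 - (q : ℂ) * (q : ℂ) ^ n)⁻¹) atTop (𝓝 1) := by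
      have h := (h2.const_mul (q : ℂ)).const_sub 1
      rw [mul_zero, sub_zero] at h
      simpa using h.inv₀ one_ne_zero
    simpa using (h2.mul_const ((q : ℂ) * (-z))).mul h4

theorem tsum_eulerCoeff {q : ℝ} (h0 : 0 < q) (h1 : q < 1) (z : ℂ) :
    ∑' m, eulerCoeff q m * z ^ m = qPochInf (z * q) q := by
  have hq : (q : ℂ) ≠ 0 := by exact_mod_cast h0.ne'
  have hs := summable_eulerCoeff h0 h1
  -- Rescaling by `1/q` makes the series a candidate for `(w;q)_∞` itself, with functional equation
  -- `f(w) = (1-w) f(wq)`.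
  set f : ℂ → ℂ := fun w => ∑' m, eulerCoeff q m * (w / q) ^ m with hf
  have hfe : ∀ w : ℂ, f w = (1 - w) * f (w * q) := by
    intro w
    have e : ∑' m, (eulerCoeff q m * (w / q) ^ m - eulerCoeff q m * (w * q / q) ^ m)
        = -w * f (w * q) := by
      rw [((hs _).sub (hs _)).tsum_eq_zero_add, hf, ← tsum_mul_left]
      simp only [pow_zero, sub_self, zero_add]
      refine tsum_congr fun m => ?_
      have h2 := one_sub_qpow_ne_zero h0 h1 m
      have h3 := qPoch_self_ne_zero h0 h1 m
      rw [eulerCoeff, eulerCoeff, triangle_succ, qPoch_succ, pow_add, mul_div_cancel_right₀ _ hq,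
        div_pow]
      field_simp
      ring
    rw [(hs _).tsum_sub (hs _)] at e
    change f w - f (w * q) = _ at e
    linear_combination e
  have h2 := qPochInf_eq_of_functional_eq h0 h1 (f := f) (z * q)
    (fun n => by rw [hfe, mul_assoc (z * (q : ℂ)), ← pow_succ]) ?_ ?_
  · rw [h2, hf]
    simp [mul_div_cancel_right₀ _ hq]
  · have := (hasDerivAt_tsum_mul_pow hs (0 / q)).continuousAt
    exact ContinuousAt.comp (f := fun w : ℂ => w / q)
      (g := fun z => ∑' n, eulerCoeff q n * z ^ n) this (by fun_prop)
  · simp only [hf, zero_div]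
    rw [tsum_eq_single 0 (fun m hm => by simp [hm])]
    simp [eulerCoeff, qPoch]

theorem summable_pow_div_qPoch {q : ℝ} (h0 : 0 < q) (h1 : q < 1) {z : ℂ} (hz : ‖z‖ < 1) :
    Summable fun j : ℕ => z ^ j / qPoch (q : ℂ) q j := by
  obtain ⟨r, hr1, hr2⟩ := exists_between hz
  have h4 : Tendsto (fun n : ℕ => ‖z * (1 - (q : ℂ) * (q : ℂ) ^ n)⁻¹‖) atTop (𝓝 ‖z‖) := by
    have h := ((tendsto_qpow h0 h1).const_mul (q : ℂ)).const_sub 1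
    rw [mul_zero, sub_zero] at h
    simpa using ((h.inv₀ one_ne_zero).const_mul z).norm
  refine summable_of_ratio_norm_eventually_le hr2 ?_
  filter_upwards [h4.eventually_lt_const hr1] with n hn
  rw [show z ^ (n + 1) / qPoch (q : ℂ) q (n + 1)
    = z * (1 - (q : ℂ) * (q : ℂ) ^ n)⁻¹ * (z ^ n / qPoch (q : ℂ) q n) by
      rw [qPoch_succ, div_eq_mul_inv, mul_inv]; ring, norm_mul]
  exact mul_le_mul_of_nonneg_right hn.le (norm_nonneg _)

/-- The series satisfies `f(wq) = (1-w) f(w)` in the unit disc, so `(z;q)_n f(z) = f(z q^n)`, and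
this tends to `1` by dominated convergence. -/
theorem qPochInf_mul_tsum {q : ℝ} (h0 : 0 < q) (h1 : q < 1) {z : ℂ} (hz : ‖z‖ < 1) :
    qPochInf z q * ∑' j : ℕ, z ^ j / qPoch (q : ℂ) q j = 1 := by
  set f : ℂ → ℂ := fun w => ∑' j : ℕ, w ^ j / qPoch (q : ℂ) q j with hf
  have hz' : ∀ n : ℕ, ‖z * (q : ℂ) ^ n‖ < 1 := fun n => by
    rw [norm_mul, norm_pow, Complex.norm_real, Real.norm_of_nonneg h0.le]
    exact (mul_le_of_le_one_right (norm_nonneg _) (pow_le_one₀ h0.le h1.le)).trans_lt hz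
  have hfe : ∀ w : ℂ, ‖w‖ < 1 → ‖w * q‖ < 1 → f (w * q) = (1 - w) * f w := by
    intro w hw hwq
    have hs := summable_pow_div_qPoch h0 h1 hw
    have hs' := summable_pow_div_qPoch h0 h1 hwq
    have e : ∑' j, (w ^ j / qPoch (q : ℂ) q j - (w * q) ^ j / qPoch (q : ℂ) q j) = w * f w := by
      rw [(hs.sub hs').tsum_eq_zero_add, hf, ← tsum_mul_left]
      simp only [pow_zero, sub_self, zero_add]
      refine tsum_congr fun m => ?_
      have h2 := one_sub_qpow_ne_zero h0 h1 m
      have h3 := qPoch_self_ne_zero h0 h1 m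
      rw [qPoch_succ]
      field_simp
      ring
    rw [hs.tsum_sub hs'] at e
    change f w - f (w * q) = _ at e
    linear_combination -e
  have hn : ∀ n : ℕ, qPoch z q n * f z = f (z * (q : ℂ) ^ n) := by
    intro n
    induction n with
    | zero => simp [qPoch]
    | succ n ih =>
      rw [qPoch_succ, mul_right_comm, ih, pow_succ, ← mul_assoc z,
        hfe _ (hz' n) (by simpa [pow_succ, mul_assoc] using hz' (n + 1)), mul_comm]
  have hc : Tendsto (fun n : ℕ => f (z * (q : ℂ) ^ n)) atTop (𝓝 1) := by
    have h2 : Tendsto (fun n : ℕ => z * (q : ℂ) ^ n) atTop (𝓝 0) := by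
      simpa using (tendsto_qpow h0 h1).const_mul z
    have h3 := tendsto_tsum_of_dominated_convergence
      (𝓕 := atTop) (f := fun (n j : ℕ) => (z * (q : ℂ) ^ n) ^ j / qPoch (q : ℂ) q j)
      (g := fun j : ℕ => (0 : ℂ) ^ j / qPoch (q : ℂ) q j)
      (summable_pow_div_qPoch h0 h1 hz).norm
      (fun j => (h2.pow j).div_const _) (Eventually.of_forall fun n j => by
        rw [norm_div, norm_div, norm_pow, norm_pow]
        gcongr
        rw [norm_mul, norm_pow, Complex.norm_real, Real.norm_of_nonneg h0.le]
        exact mul_le_of_le_one_right (norm_nonneg _) (pow_le_one₀ h0.le h1.le))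
    rw [tsum_eq_single 0 (fun m hm => by simp [hm])] at h3
    rwa [show (0 : ℂ) ^ 0 / qPoch (q : ℂ) q 0 = 1 by simp [qPoch]] at h3
  exact tendsto_nhds_unique ((tendsto_qPoch h0 h1 z).mul_const (f z)) (hc.congr fun n => (hn n).symm)

theorem qPochInf_succ {q : ℝ} (h0 : 0 < q) (h1 : q < 1) (z : ℂ) :
    qPochInf z q = (1 - z) * qPochInf (z * q) q := by
  refine tendsto_nhds_unique ((tendsto_qPoch h0 h1 z).comp (tendsto_add_atTop_nat 1)) ?_
  refine ((tendsto_qPoch h0 h1 (z * q)).const_mul (1 - z)).congr fun n => ?_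
  exact (qPoch_succ_left z q n).symm

theorem qPochInf_eq_mul {q : ℝ} (h0 : 0 < q) (h1 : q < 1) (z : ℂ) (n : ℕ) :
    qPochInf z q = qPoch z q n * qPochInf (z * (q : ℂ) ^ n) q :=
  qPoch_mul_eq_of_functional_eq (f := fun z => qPochInf z q) z
    (fun n => by rw [qPochInf_succ h0 h1, mul_assoc, ← pow_succ]) n

theorem qPochInf_zpow_eq_zero {q : ℝ} (h0 : 0 < q) (h1 : q < 1) (n : ℕ) :
    qPochInf ((q : ℂ) ^ (-(n : ℤ))) q = 0 := by
  have hq : (q : ℂ) ≠ 0 := by exact_mod_cast h0.ne'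
  rw [qPochInf_eq_mul h0 h1 _ (n + 1), qPoch_succ]
  simp [hq]

theorem qPochInf_self_ne_zero {q : ℝ} (h0 : 0 < q) (h1 : q < 1) : qPochInf (q : ℂ) q ≠ 0 := by
  have h := qPochInf_mul_tsum h0 h1 (z := q) (by simpa [abs_of_pos h0] using h1)
  exact left_ne_zero_of_mul_eq_one h

/-! ### The Gamma integral for rates in the right half-plane -/

open MeasureTheory Set in
theorem integrableOn_rpow_mul_exp_neg {σ r : ℝ} (hσ : 0 < σ) (hr : 0 < r) :
    IntegrableOn (fun t : ℝ => t ^ (σ - 1) * Real.exp (-(r * t))) (Ioi 0) := by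
  have h := integrableOn_rpow_mul_exp_neg_mul_rpow (s := σ - 1) (p := 1) (b := r) (by linarith)
    one_pos hr
  simpa using h

theorem norm_cpow_mul_cexp_neg {t : ℝ} (ht : 0 < t) (s x : ℂ) :
    ‖(t : ℂ) ^ (s - 1) * Complex.exp (-(x * t))‖ = t ^ (s.re - 1) * Real.exp (-(x.re * t)) := by
  rw [norm_mul, Complex.norm_cpow_eq_rpow_re_of_pos ht, Complex.norm_exp]
  simp

open MeasureTheory Set in
theorem aestronglyMeasurable_cpow_mul_cexp_neg (s x : ℂ) :
    AEStronglyMeasurable (fun t : ℝ => (t : ℂ) ^ (s - 1) * Complex.exp (-(x * t)))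
      (volume.restrict (Ioi 0)) := by
  refine ContinuousOn.aestronglyMeasurable (fun t ht => ?_) measurableSet_Ioi
  have h1 : ContinuousAt (fun t : ℝ => (t : ℂ) ^ (s - 1)) t :=
    Complex.continuousAt_ofReal_cpow_const _ _ (Or.inr (ne_of_gt ht))
  exact (h1.mul (by fun_prop)).continuousWithinAt

open MeasureTheory Set in
theorem integrableOn_cpow_mul_cexp_neg {s x : ℂ} (hs : 0 < s.re) (hx : 0 < x.re) :
    IntegrableOn (fun t : ℝ => (t : ℂ) ^ (s - 1) * Complex.exp (-(x * t))) (Ioi 0) := by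
  refine Integrable.mono' (integrableOn_rpow_mul_exp_neg hs hx)
    (aestronglyMeasurable_cpow_mul_cexp_neg s x) ?_
  filter_upwards [ae_restrict_mem measurableSet_Ioi] with t ht
  rw [norm_cpow_mul_cexp_neg ht]

open MeasureTheory Set in
theorem differentiableAt_integral_cpow_mul_cexp_neg {s x : ℂ} (hs : 0 < s.re) (hx : 0 < x.re) :
    DifferentiableAt ℂ
      (fun x : ℂ => ∫ t : ℝ in Ioi 0, (t : ℂ) ^ (s - 1) * Complex.exp (-(x * t))) x := by
  have hU : {z : ℂ | x.re / 2 < z.re} ∈ 𝓝 x :=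
    (isOpen_lt continuous_const Complex.continuous_re).mem_nhds (half_lt_self hx)
  refine (hasDerivAt_integral_of_dominated_loc_of_deriv_le (μ := volume.restrict (Ioi 0)) hU
    (F := fun (x : ℂ) (t : ℝ) => (t : ℂ) ^ (s - 1) * Complex.exp (-(x * t)))
    (F' := fun (x : ℂ) (t : ℝ) => (t : ℂ) ^ (s - 1) * (Complex.exp (-(x * t)) * (-t)))
    (bound := fun t => t ^ ((s.re + 1) - 1) * Real.exp (-((x.re / 2) * t)))
    (Eventually.of_forall fun z => aestronglyMeasurable_cpow_mul_cexp_neg s z)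
    (integrableOn_cpow_mul_cexp_neg hs hx) ?_ ?_
    (integrableOn_rpow_mul_exp_neg (by linarith) (by linarith)) ?_).2.differentiableAt
  · simp only [← mul_assoc]
    exact (aestronglyMeasurable_cpow_mul_cexp_neg s x).mul
      (Continuous.aestronglyMeasurable (by fun_prop))
  · filter_upwards [ae_restrict_mem measurableSet_Ioi] with t ht z hz
    have ht : 0 < t := ht
    have hz : x.re / 2 < z.re := hz
    rw [← mul_assoc, norm_mul, norm_cpow_mul_cexp_neg ht, norm_neg, Complex.norm_real,
      Real.norm_of_nonneg ht.le, mul_right_comm, add_sub_cancel_right,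
      show t ^ (s.re - 1) * t = t ^ s.re by rw [← Real.rpow_add_one ht.ne', sub_add_cancel]]
    gcongr
  · filter_upwards with t z _
    have h : HasDerivAt (fun z : ℂ => -(z * t)) (-(t : ℂ)) z := by
      simpa using ((hasDerivAt_id z).mul_const (t : ℂ)).fun_neg
    exact h.cexp.const_mul _

open MeasureTheory Set in
/-- The Gamma integral with a complex rate. -/
theorem integral_cpow_mul_cexp_neg {s x : ℂ} (hs : 0 < s.re) (hx : 0 < x.re) :
    ∫ t : ℝ in Ioi 0, (t : ℂ) ^ (s - 1) * Complex.exp (-(x * t)) = x ^ (-s) * Complex.Gamma s := by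
  have hU : IsOpen {z : ℂ | 0 < z.re} := isOpen_lt continuous_const Complex.continuous_re
  have h1 : AnalyticOnNhd ℂ
      (fun x : ℂ => ∫ t : ℝ in Ioi 0, (t : ℂ) ^ (s - 1) * Complex.exp (-(x * t)))
      {z : ℂ | 0 < z.re} :=
    DifferentiableOn.analyticOnNhd
      (fun z hz => (differentiableAt_integral_cpow_mul_cexp_neg hs hz).differentiableWithinAt) hU
  have h2 : AnalyticOnNhd ℂ (fun x : ℂ => x ^ (-s) * Complex.Gamma s) {z : ℂ | 0 < z.re} :=
    DifferentiableOn.analyticOnNhd (fun z hz =>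
      ((differentiableAt_id.cpow_const (Or.inl hz)).mul_const _).differentiableWithinAt) hU
  -- Both sides are analytic in the rate and agree for positive real rates; the real points `1 +
  -- 1/(n+1)` accumulate at `1`.
  refine h1.eqOn_of_preconnected_of_frequently_eq h2 (convex_halfSpace_re_gt 0).isPreconnected
    (z₀ := 1) (by simp) ?_ hx
  have h3 : Tendsto (fun n : ℕ => ((1 + 1 / ((n : ℝ) + 1) : ℝ) : ℂ)) atTop (𝓝[≠] 1) := by
    refine tendsto_nhdsWithin_iff.mpr ⟨?_, Eventually.of_forall fun n => ?_⟩
    · have h := (tendsto_one_div_add_atTop_nhds_zero_nat (𝕜 := ℝ)).const_add 1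
      simpa [Function.comp_def] using (Complex.continuous_ofReal.tendsto' _ _ rfl).comp h
    · have : (0 : ℝ) < 1 / ((n : ℝ) + 1) := by positivity
      intro h
      have h' : (1 + 1 / ((n : ℝ) + 1) : ℝ) = 1 := Complex.ofReal_injective (by simpa using h)
      linarith
  refine h3.frequently (Frequently.of_forall fun n => ?_)
  have hr : (0 : ℝ) < 1 + 1 / ((n : ℝ) + 1) := by positivity
  rw [Complex.integral_cpow_mul_exp_neg_mul_Ioi hs hr, one_div ((_ : ℝ) : ℂ), Complex.inv_cpow,
    Complex.cpow_neg]
  rw [Complex.arg_ofReal_of_nonneg hr.le]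
  exact Real.pi_pos.ne

/-! ### Bounds for `Γ(s) x^{-s}` -/

theorem norm_Gamma_mul_cpow_neg_le {s x : ℂ} (hs : 0 < s.re) (hx : 0 < x.re) :
    ‖Complex.Gamma s * x ^ (-s)‖ ≤ Real.Gamma s.re * x.re ^ (-s.re) := by
  rw [mul_comm, ← integral_cpow_mul_cexp_neg hs hx]
  refine (MeasureTheory.norm_integral_le_integral_norm _).trans (le_of_eq ?_)
  rw [MeasureTheory.setIntegral_congr_fun measurableSet_Ioi
    (fun t ht => norm_cpow_mul_cexp_neg ht s x), Real.integral_rpow_mul_exp_neg_mul_Ioi hs hx,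
    one_div, Real.inv_rpow hx.le, Real.rpow_neg hx.le, mul_comm]

/-- The preceding bound is used at `x = e^{iφ}`, where `|x^{-s}| = e^{φ Im s}`; taking `φ = ±θ` with
the sign of `Im s` yields the decay. -/
theorem norm_Gamma_mul_exp_le {s : ℂ} (hs : 0 < s.re) {θ : ℝ} (h1 : 0 ≤ θ) (h2 : θ < Real.pi / 2) :
    ‖Complex.Gamma s‖ ≤ Real.Gamma s.re * Real.cos θ ^ (-s.re) * Real.exp (-(θ * |s.im|)) := by
  have key : ∀ φ : ℝ, |φ| = θ → ‖Complex.Gamma s‖ * Real.exp (φ * s.im)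
      ≤ Real.Gamma s.re * Real.cos θ ^ (-s.re) := by
    intro φ hφ
    have h3 := abs_le.mp hφ.le
    have hc : (Complex.exp (φ * Complex.I)).re = Real.cos θ := by
      rw [Complex.exp_ofReal_mul_I_re, ← hφ, Real.cos_abs]
    have hpos : 0 < Real.cos θ := Real.cos_pos_of_mem_Ioo ⟨by linarith [Real.pi_pos], h2⟩
    have h := norm_Gamma_mul_cpow_neg_le hs (x := Complex.exp (φ * Complex.I)) (by rw [hc]; exact hpos)
    rw [hc, norm_mul, Complex.cpow_def_of_ne_zero (Complex.exp_ne_zero _),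
      Complex.log_exp (by simp; linarith [Real.pi_pos]) (by simp; linarith [Real.pi_pos]),
      Complex.norm_exp] at h
    simpa using h
  have hb : ‖Complex.Gamma s‖ * Real.exp (θ * |s.im|)
      ≤ Real.Gamma s.re * Real.cos θ ^ (-s.re) := by
    rcases abs_cases s.im with ⟨h, _⟩ | ⟨h, _⟩ <;> rw [h]
    · exact key θ (abs_of_nonneg h1)
    · simpa using key (-θ) (by rw [abs_neg, abs_of_nonneg h1])
  calc ‖Complex.Gamma s‖
      = ‖Complex.Gamma s‖ * Real.exp (θ * |s.im|) * Real.exp (-(θ * |s.im|)) := by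
        rw [mul_assoc, ← Real.exp_add]; simp
    _ ≤ _ := by gcongr

/-- The truncated half-discs `Re x ≥ r`, `|x| ≤ R`. -/
def truncatedHalfPlane (r R : ℝ) : Set ℂ := {x | r ≤ x.re ∧ ‖x‖ ≤ R}

/-- On a truncated half-disc, the Gamma factor decays exponentially faster than the power grows. -/
theorem exists_norm_Gamma_mul_cpow_neg_le {r : ℝ} (hr : 0 < r) (R : ℝ) :
    ∃ ρ > 0, ∃ δ > 0, ∀ x ∈ truncatedHalfPlane r R, ∀ s : ℂ, 0 < s.re →
      ‖Complex.Gamma s * x ^ (-s)‖ ≤ Real.Gamma s.re * ρ ^ (-s.re) * Real.exp (-(δ * |s.im|)) := by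
  by_cases hR : r ≤ R
  swap
  · exact ⟨1, one_pos, 1, one_pos, fun x hx =>
      absurd ((hx.1.trans (Complex.re_le_norm x)).trans hx.2) hR⟩
  have hR0 : 0 < R := hr.trans_le hR
  set θ₀ := Real.arccos (r / R) with hθ₀
  have ha : θ₀ < Real.pi / 2 := Real.arccos_lt_pi_div_two.mpr (by positivity)
  have ha0 : 0 ≤ θ₀ := Real.arccos_nonneg _
  -- On the truncated half-disc `|arg x| ≤ θ₀`, so the power grows at rate at most `θ₀` in `|Im s|`,
  -- while `Γ` decays at any rate `θ < π/2`; the surplus is `δ = θ - θ₀`.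
  obtain ⟨θ, h1, h2⟩ := exists_between ha
  have hc : 0 < Real.cos θ := Real.cos_pos_of_mem_Ioo ⟨by linarith [Real.pi_pos], h2⟩
  refine ⟨Real.cos θ * r, by positivity, θ - θ₀, by linarith, fun x hx s hs => ?_⟩
  have hxre : 0 < x.re := hr.trans_le hx.1
  have hx0 : x ≠ 0 := by rintro rfl; simp at hxre
  have hxn : r ≤ ‖x‖ := hx.1.trans (Complex.re_le_norm x)
  have hxn0 : 0 < ‖x‖ := hr.trans_le hxn
  have harg : |x.arg| ≤ θ₀ := by
    have hcos : r / R ≤ Real.cos |x.arg| := by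
      rw [Real.cos_abs, Complex.cos_arg hx0]
      exact div_le_div₀ hxre.le hx.1 hxn0 hx.2
    rw [← Real.arccos_cos (abs_nonneg x.arg) (Complex.abs_arg_le_pi x)]
    exact Real.arccos_le_arccos hcos
  rw [norm_mul, Complex.norm_cpow_of_ne_zero hx0]
  have e1 : ‖x‖ ^ (-s).re ≤ r ^ (-s.re) := by
    rw [Complex.neg_re, Real.rpow_neg hxn0.le, Real.rpow_neg hr.le]
    gcongr
  have e2 : Real.exp (x.arg * (-s).im) ≥ Real.exp (-(θ₀ * |s.im|)) := by
    rw [ge_iff_le, Real.exp_le_exp]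
    have : |x.arg * (-s).im| ≤ θ₀ * |s.im| := by
      rw [abs_mul, Complex.neg_im, abs_neg]; gcongr
    linarith [neg_abs_le (x.arg * (-s).im)]
  calc ‖Complex.Gamma s‖ * (‖x‖ ^ (-s).re / Real.exp (x.arg * (-s).im))
      ≤ (Real.Gamma s.re * Real.cos θ ^ (-s.re) * Real.exp (-(θ * |s.im|)))
          * (r ^ (-s.re) / Real.exp (-(θ₀ * |s.im|))) := by
        gcongr
        exact norm_Gamma_mul_exp_le hs (ha0.trans h1.le) h2
    _ = _ := by
        rw [Real.mul_rpow hc.le hr.le, div_eq_mul_inv, ← Real.exp_neg, neg_neg,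
          show -((θ - θ₀) * |s.im|) = -(θ * |s.im|) + θ₀ * |s.im| by ring, Real.exp_add]
        ring

/-! ### Poisson summation -/

theorem log_inv_pos {q : ℝ} (h0 : 0 < q) (h1 : q < 1) : 0 < -Real.log q :=
  neg_pos.mpr (Real.log_neg h0 h1)

theorem kappa_pos {q : ℝ} (h0 : 0 < q) (h1 : q < 1) : 0 < kappa q := by
  rw [kappa, neg_div, ← div_neg]
  exact div_pos (by positivity) (log_inv_pos h0 h1)

theorem summable_exp_neg_mul_abs {δ κ : ℝ} (hδ : 0 < δ) (hκ : 0 < κ) (y : ℝ) :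
    Summable fun k : ℤ => Real.exp (-(δ * |y + k * κ|)) := by
  have hn : Summable fun n : ℕ => Real.exp (-(δ * κ)) ^ n :=
    summable_geometric_of_lt_one (Real.exp_pos _).le
      (Real.exp_lt_one_iff.mpr (neg_lt_zero.mpr (mul_pos hδ hκ)))
  have hz : Summable fun k : ℤ => Real.exp (-(δ * κ * |(k : ℝ)|)) := by
    refine Summable.of_nat_of_neg ?_ ?_ <;>
    · refine hn.congr fun n => ?_
      rw [← Real.exp_nat_mul]
      simp
      ring
  refine Summable.of_nonneg_of_le (fun k => (Real.exp_pos _).le) (fun k => ?_)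
    (hz.mul_left (Real.exp (δ * |y|)))
  rw [← Real.exp_add, Real.exp_le_exp]
  have h : |(k : ℝ) * κ| ≤ |y + k * κ| + |y| := by
    simpa using abs_sub (y + k * κ) y
  rw [abs_mul, abs_of_pos hκ] at h
  nlinarith

/-- This is the substitution `t = e^{-u}`, read off from the Mellin transform written as a Fourier
transform. -/
theorem mellin_eq_integral_exp (f : ℝ → ℂ) (s : ℂ) :
    mellin f s = ∫ u : ℝ, Complex.exp (-s * u) * f (Real.exp (-u)) := by
  rw [mellin_eq_fourier, Real.fourier_eq']
  refine MeasureTheory.integral_congr_ae (Eventually.of_forall fun u => ?_)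
  simp only [smul_eq_mul, Complex.real_smul, ← mul_assoc]
  rw [Complex.ofReal_exp, ← Complex.exp_add]
  congr 2
  simp only [RCLike.inner_apply, conj_trivial]
  push_cast
  have hpi : (Real.pi : ℂ) ≠ 0 := by exact_mod_cast Real.pi_ne_zero
  conv_rhs => rw [← Complex.re_add_im s]
  field_simp
  ring

/-- The function interpolating `j ↦ q^{sj} exp(-x q^j)`, with `L = -ln q`. -/
def poissonKernel (L : ℝ) (s x : ℂ) (t : ℝ) : ℂ :=
  Complex.exp (-s * (L * t : ℝ)) * Complex.exp (-(x * Real.exp (-(L * t))))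

theorem norm_poissonKernel (L : ℝ) (s x : ℂ) (t : ℝ) :
    ‖poissonKernel L s x t‖ = Real.exp (-(s.re * L) * t) * Real.exp (-(x.re * Real.exp (-(L * t)))) := by
  rw [poissonKernel, norm_mul, Complex.norm_exp, Complex.norm_exp, Complex.re_mul_ofReal,
    Complex.neg_re, Complex.neg_re, Complex.re_mul_ofReal]
  congr 2
  ring

theorem poissonKernel_isBigO {L : ℝ} (hL : 0 < L) {s x : ℂ} (hs : 0 < s.re) (hx : 0 < x.re) :
    poissonKernel L s x =O[cocompact ℝ] fun t : ℝ => |t| ^ (-2 : ℝ) := by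
  have hc : 0 < s.re * L := mul_pos hs hL
  have hexp := (isLittleO_exp_neg_mul_rpow_atTop hc (-2)).isBigO
  rw [cocompact_eq_atBot_atTop, Asymptotics.isBigO_sup]
  constructor
  · have h1 : Tendsto (fun u : ℝ => Real.exp (L * u)) atTop atTop :=
      Real.tendsto_exp_atTop.comp (tendsto_id.const_mul_atTop hL)
    -- The exponent `2 Re s` exceeds the growth rate `Re s` at `-∞` by exactly `Re s`, so both ends
    -- are compared with the same exponential.
    have h2 := (tendsto_rpow_mul_exp_neg_mul_atTop_nhds_zero (2 * s.re) x.re hx).comp h1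
    have h3 : (fun u : ℝ => poissonKernel L s x (-u)) =O[atTop]
        fun u : ℝ => Real.exp (-(s.re * L) * u) := by
      have h4 := (h2.isBigO_one ℝ).mul
        (Asymptotics.isBigO_refl (fun u : ℝ => Real.exp (-(s.re * L) * u)) atTop)
      simp only [one_mul] at h4
      refine Asymptotics.IsBigO.of_norm_left (h4.congr_left fun u => ?_)
      rw [norm_poissonKernel]
      simp only [Function.comp]
      rw [← Real.exp_mul, mul_right_comm, ← Real.exp_add, mul_neg L, neg_neg, neg_mul x.re]
      congr 2
      ring
    have h5 := (h3.trans hexp).comp_tendsto tendsto_neg_atBot_atTop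
    refine h5.congr' (Eventually.of_forall fun t => by simp) ?_
    filter_upwards [eventually_le_atBot 0] with t ht
    simp [abs_of_nonpos ht]
  · refine Asymptotics.IsBigO.trans ?_ (hexp.congr' EventuallyEq.rfl ?_)
    · refine Asymptotics.IsBigO.of_bound 1 (Eventually.of_forall fun t => ?_)
      rw [norm_poissonKernel, one_mul, Real.norm_of_nonneg (Real.exp_pos _).le]
      refine mul_le_of_le_one_right (Real.exp_pos _).le (Real.exp_le_one_iff.mpr ?_)
      have := mul_pos hx (Real.exp_pos (-(L * t)))
      linarith
    · filter_upwards [eventually_ge_atTop 0] with t ht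
      rw [abs_of_nonneg ht]

-- With `L = -ln q` and `u = Lt`, the frequency `k` shifts `s` by `2πik/L = kκi`, and the Jacobian
-- is `1/L = κ/2π`; what remains is the Mellin transform of `e^{-xt}` at `s + kκi`.
open FourierTransform in
theorem fourier_poissonKernel {q : ℝ} (h0 : 0 < q) (h1 : q < 1) {s x : ℂ} (hs : 0 < s.re)
    (hx : 0 < x.re) (k : ℤ) :
    𝓕 (poissonKernel (-Real.log q) s x) k
      = kappa q / (2 * Real.pi) * (Complex.Gamma (muK q s k) * x ^ (-muK q s k)) := by
  have hL := log_inv_pos h0 h1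
  have hs' : 0 < (muK q s k).re := by simpa [muK] using hs
  have hm : mellin (fun t : ℝ => Complex.exp (-(x * t))) (muK q s k)
      = Complex.Gamma (muK q s k) * x ^ (-muK q s k) := by
    rw [mul_comm, ← integral_cpow_mul_cexp_neg hs' hx]
    rfl
  rw [← hm, mellin_eq_integral_exp, Real.fourier_eq']
  have h2 := MeasureTheory.Measure.integral_comp_mul_left
    (fun u : ℝ => Complex.exp (-muK q s k * u) * Complex.exp (-(x * (Real.exp (-u) : ℝ)))) (-Real.log q)
  have hl : (Real.log q : ℂ) ≠ 0 := by exact_mod_cast (Real.log_neg h0 h1).ne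
  have hpi : (Real.pi : ℂ) ≠ 0 := by exact_mod_cast Real.pi_ne_zero
  have h3 : (kappa q : ℂ) / (2 * Real.pi) = ((|(-Real.log q)⁻¹| : ℝ) : ℂ) := by
    rw [abs_of_pos (inv_pos.mpr hL), kappa]
    push_cast
    field_simp
  rw [h3, ← Complex.real_smul, ← h2]
  refine MeasureTheory.integral_congr_ae (Eventually.of_forall fun t => ?_)
  simp only [poissonKernel, smul_eq_mul, ← mul_assoc]
  rw [← Complex.exp_add]
  congr 2
  simp only [RCLike.inner_apply, conj_trivial, muK, kappa]
  push_cast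
  field_simp
  ring

theorem poissonKernel_intCast {q : ℝ} (h0 : 0 < q) (s x : ℂ) (j : ℤ) :
    poissonKernel (-Real.log q) s x j
      = ((q : ℂ) ^ s) ^ j * Complex.exp (-(x * (q : ℂ) ^ j)) := by
  have hq : (q : ℂ) ≠ 0 := by exact_mod_cast h0.ne'
  have h1 : Real.exp (-(-Real.log q * j)) = q ^ j := by
    rw [← Real.rpow_intCast, Real.rpow_def_of_pos h0]
    congr 1
    ring
  rw [poissonKernel, h1, ← Complex.cpow_mul_int, Complex.cpow_def_of_ne_zero hq, ← Complex.ofReal_log h0.le]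
  push_cast
  congr 2
  ring

theorem summable_norm_Gamma_mul_cpow {q : ℝ} (h0 : 0 < q) (h1 : q < 1) {s x : ℂ} (hs : 0 < s.re)
    (hx : 0 < x.re) :
    Summable fun k : ℤ => ‖Complex.Gamma (muK q s k) * x ^ (-muK q s k)‖ := by
  obtain ⟨ρ, hρ, δ, hδ, h⟩ := exists_norm_Gamma_mul_cpow_neg_le hx ‖x‖
  have hre : ∀ k, (muK q s k).re = s.re := fun k => by simp [muK]
  have him : ∀ k : ℤ, (muK q s k).im = s.im + k * kappa q := fun k => by simp [muK]
  refine Summable.of_nonneg_of_le (fun k => norm_nonneg _)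
    (fun k => h x ⟨le_rfl, le_rfl⟩ _ (by rwa [hre])) ?_
  simp only [hre, him]
  exact (summable_exp_neg_mul_abs hδ (kappa_pos h0 h1) _).mul_left _

theorem summable_zpow_mul_exp {q : ℝ} (h0 : 0 < q) (h1 : q < 1) {s x : ℂ} (hs : 0 < s.re)
    (hx : 0 < x.re) :
    Summable fun j : ℤ => ((q : ℂ) ^ s) ^ j * Complex.exp (-(x * (q : ℂ) ^ j)) := by
  have h := summable_of_isBigO (Real.summable_abs_int_rpow (b := 2) (by norm_num))
    ((poissonKernel_isBigO (log_inv_pos h0 h1) hs hx).comp_tendsto Int.tendsto_coe_cofinite)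
  exact h.congr fun j => poissonKernel_intCast h0 s x j

theorem tsum_zpow_mul_exp {q : ℝ} (h0 : 0 < q) (h1 : q < 1) {s x : ℂ} (hs : 0 < s.re)
    (hx : 0 < x.re) :
    ∑' j : ℤ, ((q : ℂ) ^ s) ^ j * Complex.exp (-(x * (q : ℂ) ^ j))
      = kappa q / (2 * Real.pi) * ∑' k : ℤ, Complex.Gamma (muK q s k) * x ^ (-muK q s k) := by
  have h := Real.tsum_eq_tsum_fourier_of_rpow_decay_of_summable
    (f := poissonKernel (-Real.log q) s x) (by unfold poissonKernel; fun_prop) (b := 2)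
    (by norm_num) (poissonKernel_isBigO (log_inv_pos h0 h1) hs hx)
    (((summable_norm_Gamma_mul_cpow h0 h1 hs hx).of_norm.mul_left _).congr
      fun k => (fourier_poissonKernel h0 h1 hs hx k).symm) 0
  simp only [zero_add, QuotientAddGroup.mk_zero, fourier_eval_zero, mul_one,
    fourier_poissonKernel h0 h1 hs hx, poissonKernel_intCast h0] at h
  rw [h, tsum_mul_left]

/-! ### The expansion of `F` in exponentials -/

theorem norm_qpow {q : ℝ} (h0 : 0 < q) (μ : ℂ) : ‖(q : ℂ) ^ μ‖ = q ^ μ.re :=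
  Complex.norm_cpow_eq_rpow_re_of_pos h0 μ

theorem norm_qpow_lt_one {q : ℝ} (h0 : 0 < q) (h1 : q < 1) {μ : ℂ} (hμ : 0 < μ.re) :
    ‖(q : ℂ) ^ μ‖ < 1 := by
  rw [norm_qpow h0]
  exact Real.rpow_lt_one h0.le h1 hμ

/-- Write `(z;q)_n = (z;q)_∞ / (z q^n;q)_∞` with `z = q^μ` and expand the reciprocal, which needs
`|z| < 1`; after the interchange the sum over `n` is an exponential series in `-x q^j`. -/
theorem F_eq_tsum_exp {q : ℝ} (h0 : 0 < q) (h1 : q < 1) {μ : ℂ} (hμ : 0 < μ.re) (x : ℂ) :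
    F μ q x = qPochInf ((q : ℂ) ^ μ) q
      * ∑' j : ℕ, ((q : ℂ) ^ μ) ^ j / qPoch (q : ℂ) q j * Complex.exp (-(x * (q : ℂ) ^ j)) := by
  set z := (q : ℂ) ^ μ with hz
  have hz1 : ‖z‖ < 1 := norm_qpow_lt_one h0 h1 hμ
  have hqn : ∀ n : ℕ, ‖(q : ℂ) ^ n‖ ≤ 1 := fun n => by
    rw [norm_pow, Complex.norm_real, Real.norm_of_nonneg h0.le]
    exact pow_le_one₀ h0.le h1.le
  have hzn : ∀ n : ℕ, ‖z * (q : ℂ) ^ n‖ < 1 := fun n => by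
    rw [norm_mul]
    exact (mul_le_of_le_one_right (norm_nonneg _) (hqn n)).trans_lt hz1
  have hP : ∀ n : ℕ, qPoch z q n
      = qPochInf z q * ∑' j : ℕ, (z * (q : ℂ) ^ n) ^ j / qPoch (q : ℂ) q j := fun n => by
    rw [qPochInf_eq_mul h0 h1 z n, mul_assoc, qPochInf_mul_tsum h0 h1 (hzn n), mul_one]
  have hexp : ∀ y : ℂ, ∑' n : ℕ, y ^ n / (n.factorial : ℂ) = Complex.exp y := fun y => by
    rw [Complex.exp_eq_exp_ℂ, NormedSpace.exp_eq_tsum_div]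
  have hsum : Summable (fun p : ℕ × ℕ =>
      (z * (q : ℂ) ^ p.1) ^ p.2 / qPoch (q : ℂ) q p.2 * ((-x) ^ p.1 / (p.1.factorial : ℂ))) := by
    have hb := (NormedSpace.expSeries_div_summable (-x)).norm.mul_of_nonneg
      (summable_pow_div_qPoch h0 h1 hz1).norm (fun _ => norm_nonneg _) (fun _ => norm_nonneg _)
    refine Summable.of_norm_bounded hb fun p => ?_
    rw [norm_mul, mul_comm]
    refine mul_le_mul_of_nonneg_left ?_ (norm_nonneg _)
    rw [norm_div, norm_div, mul_pow, norm_mul]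
    gcongr
    refine mul_le_of_le_one_right (norm_nonneg _) ?_
    rw [norm_pow]
    exact pow_le_one₀ (norm_nonneg _) (hqn _)
  calc F μ q x = ∑' n : ℕ, qPochInf z q * ∑' j : ℕ,
        (z * (q : ℂ) ^ n) ^ j / qPoch (q : ℂ) q j * ((-x) ^ n / (n.factorial : ℂ)) := by
        rw [F]
        refine tsum_congr fun n => ?_
        rw [← hz, hP, tsum_mul_right]
        ring
    _ = qPochInf z q * ∑' (j : ℕ) (n : ℕ),
        (z * (q : ℂ) ^ n) ^ j / qPoch (q : ℂ) q j * ((-x) ^ n / (n.factorial : ℂ)) := by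
        rw [tsum_mul_left]
        congr 1
        exact (Summable.tsum_comm (f := fun n j : ℕ =>
          (z * (q : ℂ) ^ n) ^ j / qPoch (q : ℂ) q j * ((-x) ^ n / (n.factorial : ℂ))) hsum).symm
    _ = _ := by
        congr 1
        refine tsum_congr fun j => ?_
        rw [← hexp, ← tsum_mul_left]
        refine tsum_congr fun n => ?_
        rw [← neg_mul, mul_pow, mul_pow, ← pow_mul, ← pow_mul, mul_comm n j]
        ring

/-! ### The terms of the connection formula -/

/-- The `k`-th term of the connection formula. -/
def connTerm (q : ℝ) (μ x : ℂ) (k : ℤ) : ℂ :=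
  Complex.Gamma (muK q μ k) * x ^ (-muK q μ k) * G (muK q μ k) q (1 / x)

theorem Gamma_add_natCast {a : ℂ} (ha : 0 < a.re) (m : ℕ) :
    Complex.Gamma (a + m) = (ascPochhammer ℂ m).eval a * Complex.Gamma a := by
  induction m with
  | zero => simp
  | succ m ih =>
    have hne : a + m ≠ 0 := fun h => by
      have := congrArg Complex.re h
      simp at this
      linarith [(Nat.cast_nonneg m : (0 : ℝ) ≤ m)]
    rw [Nat.cast_succ, ← add_assoc, Complex.Gamma_add_one _ hne, ih, ascPochhammer_succ_eval]
    ring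

theorem muK_add_natCast (q : ℝ) (μ : ℂ) (k : ℤ) (m : ℕ) : muK q (μ + m) k = muK q μ k + m := by
  simp only [muK]; ring

theorem muK_re (q : ℝ) (μ : ℂ) (k : ℤ) : (muK q μ k).re = μ.re := by simp [muK]

theorem muK_im (q : ℝ) (μ : ℂ) (k : ℤ) : (muK q μ k).im = μ.im + k * kappa q := by simp [muK]

theorem eulerCoeff_mul_Gamma {q : ℝ} {a x : ℂ} (ha : 0 < a.re) (hx : x ≠ 0) (m : ℕ) :
    eulerCoeff q m * (Complex.Gamma (a + m) * x ^ (-(a + m)))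
      = Complex.Gamma a * x ^ (-a) * ((ascPochhammer ℂ m).eval a * (q : ℂ) ^ (m * (m + 1) / 2)
        / qPoch (q : ℂ) q m * (-(1 / x)) ^ m) := by
  rw [Gamma_add_natCast ha, neg_add, Complex.cpow_add _ _ hx, Complex.cpow_neg _ (m : ℂ),
    Complex.cpow_natCast, eulerCoeff, neg_pow (1 / x), one_div, inv_pow]
  ring

theorem tsum_eulerCoeff_mul_Gamma {q : ℝ} {a x : ℂ} (ha : 0 < a.re) (hx : x ≠ 0) :
    ∑' m : ℕ, eulerCoeff q m * (Complex.Gamma (a + m) * x ^ (-(a + m)))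
      = Complex.Gamma a * x ^ (-a) * G a q (1 / x) := by
  simp only [eulerCoeff_mul_Gamma ha hx, tsum_mul_left]
  rfl

/-- At the real parameters `a = σ`, `x = ρ` these are, up to a constant factor, the absolute values
of the terms of the everywhere convergent series `G(σ;q,1/ρ)`. -/
theorem summable_eulerCoeff_mul_Gamma {q : ℝ} (h0 : 0 < q) (h1 : q < 1) {σ ρ : ℝ} (hσ : 0 < σ)
    (hρ : 0 < ρ) :
    Summable fun m : ℕ => ‖eulerCoeff q m‖ * (Real.Gamma (σ + m) * ρ ^ (-(σ + m))) := by
  have hs : 0 < (σ : ℂ).re := hσ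
  have h := ((summable_G h0 h1 σ (1 / ρ)).mul_left (Complex.Gamma σ * (ρ : ℂ) ^ (-(σ : ℂ)))).norm
  refine h.congr fun m => ?_
  rw [← eulerCoeff_mul_Gamma hs (by exact_mod_cast hρ.ne'), norm_mul, norm_mul]
  have hm : 0 < σ + m := by positivity
  congr 2
  · rw [← Complex.ofReal_natCast, ← Complex.ofReal_add, Complex.Gamma_ofReal, Complex.norm_real,
      Real.norm_of_nonneg (Real.Gamma_pos_of_pos hm).le]
  · rw [Complex.norm_cpow_eq_rpow_re_of_pos hρ]
    simp

/-- The bound on `Γ(s) x^{-s}` separates `Re s` from `Im s`; for `s = μ_k + m` the former depends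
only on `m` and the latter only on `k`. -/
theorem exists_norm_eulerCoeff_mul_Gamma_le {q : ℝ} (h0 : 0 < q) (h1 : q < 1) {μ : ℂ}
    (hμ : 0 < μ.re) {r : ℝ} (hr : 0 < r) (R : ℝ) :
    ∃ (A : ℕ → ℝ) (B : ℤ → ℝ), Summable A ∧ Summable B ∧ (∀ m, 0 ≤ A m) ∧ (∀ k, 0 ≤ B k) ∧
      ∀ x ∈ truncatedHalfPlane r R, ∀ m k,
        ‖eulerCoeff q m * (Complex.Gamma (muK q μ k + m) * x ^ (-(muK q μ k + m)))‖ ≤ A m * B k := by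
  obtain ⟨ρ, hρ, δ, hδ, h⟩ := exists_norm_Gamma_mul_cpow_neg_le hr R
  refine ⟨_, _, summable_eulerCoeff_mul_Gamma h0 h1 hμ hρ,
    summable_exp_neg_mul_abs hδ (kappa_pos h0 h1) μ.im, fun m => ?_, fun k => (Real.exp_pos _).le,
    fun x hx m k => ?_⟩
  · have hm : 0 < μ.re + m := by positivity
    have := Real.Gamma_pos_of_pos hm
    positivity
  · have hre : (muK q μ k + m).re = μ.re + m := by simp [muK_re]
    have him : (muK q μ k + m).im = μ.im + k * kappa q := by simp [muK_im]
    have h2 := h x hx (muK q μ k + m) (by rw [hre]; positivity)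
    rw [hre, him] at h2
    rw [norm_mul, mul_assoc]
    gcongr

/-- The connection series is normally convergent on truncated half-discs. -/
def ConnNormal (q : ℝ) (μ : ℂ) : Prop :=
  ∀ r > 0, ∀ R, ∃ u : ℤ → ℝ, Summable u ∧ ∀ x ∈ truncatedHalfPlane r R, ∀ k,
    ‖connTerm q μ x k‖ ≤ u k

theorem ne_zero_of_mem_truncatedHalfPlane {r R : ℝ} (hr : 0 < r) {x : ℂ}
    (hx : x ∈ truncatedHalfPlane r R) : x ≠ 0 := by
  rintro rfl
  have := hx.1
  simp at this
  linarith

theorem connNormal_of_re_pos {q : ℝ} (h0 : 0 < q) (h1 : q < 1) {μ : ℂ} (hμ : 0 < μ.re) :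
    ConnNormal q μ := by
  intro r hr R
  obtain ⟨A, B, hA, hB, hA0, hB0, h⟩ := exists_norm_eulerCoeff_mul_Gamma_le h0 h1 hμ hr R
  refine ⟨fun k => (∑' m, A m) * B k, hB.mul_left _, fun x hx k => ?_⟩
  rw [connTerm, ← tsum_eulerCoeff_mul_Gamma (by rwa [muK_re])
    (ne_zero_of_mem_truncatedHalfPlane hr hx)]
  exact tsum_of_norm_bounded (hA.hasSum.mul_right (B k)) fun m => h x hx m k

theorem tsum_connTerm_eq {q : ℝ} (h0 : 0 < q) (h1 : q < 1) {μ x : ℂ} (hμ : 0 < μ.re)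
    (hx : 0 < x.re) :
    kappa q / (2 * Real.pi) * ∑' k : ℤ, connTerm q μ x k
      = ∑' m : ℕ, ∑' j : ℤ,
        eulerCoeff q m * (((q : ℂ) ^ (μ + m)) ^ j * Complex.exp (-(x * (q : ℂ) ^ j))) := by
  have hxm : x ∈ truncatedHalfPlane x.re ‖x‖ := ⟨le_rfl, le_rfl⟩
  obtain ⟨A, B, hA, hB, hA0, hB0, h⟩ := exists_norm_eulerCoeff_mul_Gamma_le h0 h1 hμ hx ‖x‖
  have hx0 := ne_zero_of_mem_truncatedHalfPlane hx hxm
  have hs : Summable fun p : ℕ × ℤ =>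
      eulerCoeff q p.1 * (Complex.Gamma (muK q μ p.2 + p.1) * x ^ (-(muK q μ p.2 + p.1))) :=
    Summable.of_norm_bounded (hA.mul_of_nonneg hB hA0 hB0) fun p => h x hxm p.1 p.2
  have h2 : ∀ k, connTerm q μ x k
      = ∑' m : ℕ, eulerCoeff q m * (Complex.Gamma (muK q μ k + m) * x ^ (-(muK q μ k + m))) :=
    fun k => (tsum_eulerCoeff_mul_Gamma (by rwa [muK_re]) hx0).symm
  simp only [h2]
  rw [Summable.tsum_comm (f := fun (m : ℕ) (k : ℤ) =>
    eulerCoeff q m * (Complex.Gamma (muK q μ k + m) * x ^ (-(muK q μ k + m)))) hs, ← tsum_mul_left]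
  refine tsum_congr fun m => ?_
  have hm : 0 < (μ + m).re := by
    simp only [Complex.add_re, Complex.natCast_re]; positivity
  rw [tsum_mul_left, tsum_mul_left, tsum_zpow_mul_exp h0 h1 hm hx]
  simp only [muK_add_natCast]
  ring

/-- Taking norms replaces `μ` and `x` by their real parts, so Poisson summation also evaluates the
sum of the norms. -/
theorem norm_zpow_mul_exp {q : ℝ} (h0 : 0 < q) (μ x : ℂ) (j : ℤ) :
    ((‖((q : ℂ) ^ μ) ^ j * Complex.exp (-(x * (q : ℂ) ^ j))‖ : ℝ) : ℂ)
      = ((q : ℂ) ^ (μ.re : ℂ)) ^ j * Complex.exp (-((x.re : ℂ) * (q : ℂ) ^ j)) := by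
  rw [norm_mul, norm_zpow, norm_qpow h0, Complex.norm_exp, ← Complex.ofReal_zpow, Complex.neg_re,
    Complex.re_mul_ofReal]
  push_cast
  rw [Complex.ofReal_cpow h0.le]

theorem tsum_norm_zpow_mul_exp {q : ℝ} (h0 : 0 < q) (h1 : q < 1) {μ x : ℂ} (hμ : 0 < μ.re)
    (hx : 0 < x.re) :
    ∑' j : ℤ, ‖((q : ℂ) ^ μ) ^ j * Complex.exp (-(x * (q : ℂ) ^ j))‖
      = kappa q / (2 * Real.pi) * ‖∑' k : ℤ, Complex.Gamma (muK q μ.re k)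
        * (x.re : ℂ) ^ (-muK q μ.re k)‖ := by
  have h := tsum_zpow_mul_exp h0 h1 (s := μ.re) (x := x.re) (by simpa) (by simpa)
  simp only [← norm_zpow_mul_exp h0] at h
  rw [← Complex.ofReal_tsum] at h
  have h2 := congrArg norm h
  rw [Complex.norm_real, Real.norm_of_nonneg (tsum_nonneg fun _ => norm_nonneg _), norm_mul,
    norm_div, norm_mul, Complex.norm_real, Complex.norm_real,
    Real.norm_of_nonneg (kappa_pos h0 h1).le, Real.norm_of_nonneg Real.pi_pos.le] at h2
  simpa using h2

theorem summable_eulerCoeff_mul_zpow_mul_exp {q : ℝ} (h0 : 0 < q) (h1 : q < 1) {μ x : ℂ}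
    (hμ : 0 < μ.re) (hx : 0 < x.re) :
    Summable fun p : ℕ × ℤ => eulerCoeff q p.1
      * (((q : ℂ) ^ (μ + p.1)) ^ p.2 * Complex.exp (-(x * (q : ℂ) ^ p.2))) := by
  have hm : ∀ m : ℕ, 0 < (μ + m).re := fun m => by
    simp only [Complex.add_re, Complex.natCast_re]; positivity
  obtain ⟨A, B, hA, hB, hA0, hB0, h⟩ :=
    exists_norm_eulerCoeff_mul_Gamma_le h0 h1 (μ := μ.re) (by simpa) hx ‖(x.re : ℂ)‖
  have hxm : (x.re : ℂ) ∈ truncatedHalfPlane x.re ‖(x.re : ℂ)‖ :=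
    ⟨(Complex.ofReal_re _).ge, le_rfl⟩
  rw [← summable_norm_iff, summable_prod_of_nonneg (fun _ => norm_nonneg _)]
  refine ⟨fun m => ((summable_zpow_mul_exp h0 h1 (hm m) hx).mul_left (eulerCoeff q m)).norm, ?_⟩
  refine Summable.of_nonneg_of_le (fun m => tsum_nonneg fun _ => norm_nonneg _) (fun m => ?_)
    ((hA.mul_right (∑' k, B k)).mul_left (kappa q / (2 * Real.pi)))
  simp only [norm_mul (eulerCoeff q m), tsum_mul_left]
  have e : (((μ + m).re : ℝ) : ℂ) = μ.re + m := by simp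
  rw [tsum_norm_zpow_mul_exp h0 h1 (hm m) hx, e, mul_left_comm, ← norm_mul, ← tsum_mul_left]
  simp only [muK_add_natCast]
  refine mul_le_mul_of_nonneg_left ?_ (div_nonneg (kappa_pos h0 h1).le (by positivity))
  exact tsum_of_norm_bounded (hB.hasSum.mul_left (A m)) fun k => h _ hxm m k

theorem F_eq_tsum_connTerm_of_re_pos {q : ℝ} (h0 : 0 < q) (h1 : q < 1) {μ x : ℂ} (hμ : 0 < μ.re)
    (hx : 0 < x.re) :
    F μ q x = kappa q * qPochInf ((q : ℂ) ^ μ) q / (2 * Real.pi * qPochInf (q : ℂ) q)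
      * ∑' k : ℤ, connTerm q μ x k := by
  have hq : (q : ℂ) ≠ 0 := by exact_mod_cast h0.ne'
  have hne := qPochInf_self_ne_zero h0 h1
  have key : kappa q / (2 * Real.pi) * ∑' k : ℤ, connTerm q μ x k
      = qPochInf (q : ℂ) q * ∑' j : ℕ, ((q : ℂ) ^ μ) ^ j / qPoch (q : ℂ) q j
        * Complex.exp (-(x * (q : ℂ) ^ j)) := by
    rw [tsum_connTerm_eq h0 h1 hμ hx, ← Summable.tsum_comm (f := fun (m : ℕ) (j : ℤ) =>
      eulerCoeff q m * (((q : ℂ) ^ (μ + m)) ^ j * Complex.exp (-(x * (q : ℂ) ^ j))))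
      (summable_eulerCoeff_mul_zpow_mul_exp h0 h1 hμ hx)]
    have e : ∀ j : ℤ, ∑' m : ℕ,
        eulerCoeff q m * (((q : ℂ) ^ (μ + m)) ^ j * Complex.exp (-(x * (q : ℂ) ^ j)))
        = ((q : ℂ) ^ μ) ^ j * Complex.exp (-(x * (q : ℂ) ^ j)) * qPochInf ((q : ℂ) ^ (j + 1)) q := by
      intro j
      rw [zpow_add_one₀ hq, ← tsum_eulerCoeff h0 h1, ← tsum_mul_left]
      refine tsum_congr fun m => ?_
      rw [Complex.cpow_add _ _ hq, Complex.cpow_natCast, mul_zpow, ← zpow_natCast (_ ^ j),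
        ← zpow_mul, mul_comm j, zpow_mul, zpow_natCast]
      ring
    simp only [e]
    -- Only `j ≥ 0` contributes: for `j < 0` the exponent `j + 1` is `-n` with `n ≥ 0`, and
    -- `(q^{-n};q)_∞` has a zero factor.
    rw [← Function.Injective.tsum_eq (g := ((↑) : ℕ → ℤ)) Nat.cast_injective, ← tsum_mul_left]
    · refine tsum_congr fun j => ?_
      rw [qPochInf_eq_mul h0 h1 (q : ℂ) j, zpow_add_one₀ hq, zpow_natCast, zpow_natCast,
        mul_comm _ (q : ℂ)]
      have := qPoch_self_ne_zero h0 h1 j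
      field_simp
    · intro j hj
      by_contra hneg
      have hj0 : j < 0 := by
        by_contra h
        exact hneg ⟨j.toNat, by simpa using not_lt.mp h⟩
      obtain ⟨n, hn⟩ := Int.eq_ofNat_of_zero_le (a := -(j + 1)) (by omega)
      refine hj ?_
      simp only [show j + 1 = -(n : ℤ) by omega, qPochInf_zpow_eq_zero h0 h1, mul_zero]
  rw [F_eq_tsum_exp h0 h1 hμ, mul_comm (2 * (Real.pi : ℂ)), mul_comm (kappa q : ℂ), mul_div_mul_comm,
    mul_assoc, key, ← mul_assoc, div_mul_cancel₀ _ hne]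

/-! ### Descent from `μ + 1` to `μ` -/

theorem connTerm_eq_exp (q : ℝ) (μ : ℂ) (k : ℤ) {x : ℂ} (hx : x ≠ 0) :
    connTerm q μ x k = Complex.Gamma (muK q μ k)
      * (Complex.exp (-muK q μ k * Complex.log x) * G (muK q μ k) q (1 / x)) := by
  rw [connTerm, Complex.cpow_def_of_ne_zero hx, mul_comm (Complex.log x), mul_assoc]

theorem muK_add_one (q : ℝ) (μ : ℂ) (k : ℤ) : muK q (μ + 1) k = muK q μ k + 1 := by
  simpa using muK_add_natCast q μ k 1

theorem connTerm_add_one {q : ℝ} {μ : ℂ} {k : ℤ} (hk : muK q μ k ≠ 0) {x : ℂ} (hx : x ≠ 0) :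
    connTerm q (μ + 1) x k = Complex.Gamma (muK q μ k) * (muK q μ k * x⁻¹
      * Complex.exp (-muK q μ k * Complex.log x) * G (muK q μ k + 1) q (1 / x)) := by
  rw [connTerm, muK_add_one, Complex.Gamma_add_one _ hk, neg_add, Complex.cpow_add _ _ hx,
    Complex.cpow_neg_one, Complex.cpow_def_of_ne_zero hx, mul_comm (Complex.log x)]
  ring

theorem hasDerivAt_connTerm {q : ℝ} (h0 : 0 < q) (h1 : q < 1) {μ : ℂ} {k : ℤ}
    (hk : muK q μ k ≠ 0) {x : ℂ} (hx : x ∈ Complex.slitPlane) :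
    HasDerivAt (fun z => connTerm q μ z k) (-connTerm q (μ + 1) x k) x := by
  have hx0 := Complex.slitPlane_ne_zero hx
  have h := (hasDerivAt_exp_mul_G h0 h1 (muK q μ k) hx0 (Complex.hasDerivAt_log hx)).const_mul
    (Complex.Gamma (muK q μ k))
  refine (h.congr_of_eventuallyEq ?_).congr_deriv (by rw [connTerm_add_one hk hx0]; ring)
  filter_upwards [isOpen_ne.mem_nhds hx0] with z hz using connTerm_eq_exp q μ k hz

theorem connTerm_sub_scale {q : ℝ} (h0 : 0 < q) (h1 : q < 1) {μ : ℂ} {k : ℤ}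
    (hk : muK q μ k ≠ 0) {x : ℂ} (hx : x ≠ 0) :
    connTerm q μ x k - (q : ℂ) ^ μ * connTerm q μ (q * x) k = connTerm q (μ + 1) x k := by
  have hq : (q : ℂ) ≠ 0 := by exact_mod_cast h0.ne'
  have h := exp_mul_G_scale_sub h0 h1 (μ := μ) (k := k) (Complex.log x) x
  rw [connTerm_add_one hk hx, connTerm_eq_exp _ _ _ hx, connTerm_eq_exp _ _ _ (mul_ne_zero hq hx),
    Complex.log_ofReal_mul h0 hx]
  linear_combination -Complex.Gamma (muK q μ k) * h

theorem convex_truncatedHalfPlane (r R : ℝ) : Convex ℝ (truncatedHalfPlane r R) := by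
  have h : truncatedHalfPlane r R = {z : ℂ | r ≤ z.re} ∩ Metric.closedBall 0 R := by
    ext z
    simp [truncatedHalfPlane]
  rw [h]
  exact (convex_halfSpace_re_ge r).inter (convex_closedBall _ _)

theorem scale_mem_truncatedHalfPlane {q r R : ℝ} (h0 : 0 < q) (h1 : q < 1) {x : ℂ}
    (hx : x ∈ truncatedHalfPlane r R) : (q : ℂ) * x ∈ truncatedHalfPlane (q * r) R := by
  refine ⟨?_, ?_⟩
  · rw [Complex.re_ofReal_mul]
    exact mul_le_mul_of_nonneg_left hx.1 h0.le
  · rw [norm_mul, Complex.norm_real, Real.norm_of_nonneg h0.le]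
    exact (mul_le_of_le_one_left (norm_nonneg _) h1.le).trans hx.2

theorem truncatedHalfPlane_subset {r r' R : ℝ} (h : r' ≤ r) :
    truncatedHalfPlane r R ⊆ truncatedHalfPlane r' R := fun _ hx => ⟨h.trans hx.1, hx.2⟩

theorem mem_slitPlane_of_re_pos {x : ℂ} (hx : 0 < x.re) : x ∈ Complex.slitPlane := Or.inl hx

/-- With `T_μ` the `k`-th term, `(1-q^μ) T_μ(x) = T_{μ+1}(x) + q^μ (T_μ(qx) - T_μ(x))`. Since `T_μ'
= -T_{μ+1}`, the mean value inequality bounds the difference by the majorant for `μ+1`. -/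
theorem ConnNormal.of_add_one {q : ℝ} (h0 : 0 < q) (h1 : q < 1) {μ : ℂ}
    (hμ : (q : ℂ) ^ μ ≠ 1) (hk : ∀ k, muK q μ k ≠ 0) (h : ConnNormal q (μ + 1)) :
    ConnNormal q μ := by
  intro r hr R
  have hqr : 0 < q * r := mul_pos h0 hr
  -- The region is enlarged to `Re ≥ qr` so that it contains the segment from `x` to `qx`.
  obtain ⟨u, hu, hb⟩ := h (q * r) hqr R
  have hc : 0 < ‖1 - (q : ℂ) ^ μ‖ := norm_pos_iff.mpr (sub_ne_zero.mpr (Ne.symm hμ))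
  refine ⟨fun k => ‖1 - (q : ℂ) ^ μ‖⁻¹ * (1 + ‖(q : ℂ) ^ μ‖ * (2 * R)) * u k, hu.mul_left _,
    fun x hx k => ?_⟩
  have hxm : x ∈ truncatedHalfPlane (q * r) R :=
    truncatedHalfPlane_subset (mul_le_of_le_one_left hr.le h1.le) hx
  have hqx := scale_mem_truncatedHalfPlane h0 h1 hx
  have hx0 := ne_zero_of_mem_truncatedHalfPlane hr hx
  have hu0 : 0 ≤ u k := (norm_nonneg _).trans (hb x hxm k)
  have hmv := (convex_truncatedHalfPlane (q * r) R).norm_image_sub_le_of_norm_hasDerivWithin_le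
    (f := fun z => connTerm q μ z k) (f' := fun z => -connTerm q (μ + 1) z k) (C := u k)
    (fun z hz => (hasDerivAt_connTerm h0 h1 (hk k)
      (mem_slitPlane_of_re_pos (hqr.trans_le hz.1))).hasDerivWithinAt)
    (fun z hz => by rw [norm_neg]; exact hb z hz k) hxm hqx
  have hdist : ‖(q : ℂ) * x - x‖ ≤ 2 * R := by
    linarith [norm_sub_le ((q : ℂ) * x) x, hqx.2, hxm.2]
  have heq : connTerm q μ x k * (1 - (q : ℂ) ^ μ) = connTerm q (μ + 1) x k
      + (q : ℂ) ^ μ * (connTerm q μ (q * x) k - connTerm q μ x k) := by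
    rw [← connTerm_sub_scale h0 h1 (hk k) hx0]
    ring
  beta_reduce
  rw [mul_assoc, inv_mul_eq_div, le_div_iff₀ hc, ← norm_mul, heq]
  calc _ ≤ ‖connTerm q (μ + 1) x k‖ + ‖(q : ℂ) ^ μ‖ * ‖connTerm q μ (q * x) k - connTerm q μ x k‖ := by
        rw [← norm_mul]; exact norm_add_le _ _
    _ ≤ u k + ‖(q : ℂ) ^ μ‖ * (u k * (2 * R)) := by
        gcongr
        · exact hb x hxm k
        · exact hmv.trans (by gcongr)
    _ = _ := by ring

theorem ConnNormal.summable {q : ℝ} {μ : ℂ} (h : ConnNormal q μ) {x : ℂ} (hx : 0 < x.re) :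
    Summable (connTerm q μ x) := by
  obtain ⟨u, hu, hb⟩ := h x.re hx ‖x‖
  exact Summable.of_norm_bounded hu (hb x ⟨le_rfl, le_rfl⟩)

theorem hasDerivAt_tsum_connTerm {q : ℝ} (h0 : 0 < q) (h1 : q < 1) {μ : ℂ}
    (hk : ∀ k, muK q μ k ≠ 0) (h : ConnNormal q μ) (h' : ConnNormal q (μ + 1)) {x : ℂ}
    (hx : 0 < x.re) :
    HasDerivAt (fun z => ∑' k, connTerm q μ z k) (-∑' k, connTerm q (μ + 1) x k) x := by
  obtain ⟨u, hu, hb⟩ := h' (x.re / 2) (by linarith) (‖x‖ + 1)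
  have hsub : ∀ z ∈ {z : ℂ | x.re / 2 < z.re} ∩ Metric.ball 0 (‖x‖ + 1),
      z ∈ truncatedHalfPlane (x.re / 2) (‖x‖ + 1) := fun z hz =>
    ⟨le_of_lt hz.1, (mem_ball_zero_iff.mp hz.2).le⟩
  have hxm : x ∈ {z : ℂ | x.re / 2 < z.re} ∩ Metric.ball 0 (‖x‖ + 1) :=
    ⟨half_lt_self hx, by simp⟩
  rw [← tsum_neg]
  refine hasDerivAt_tsum_of_isPreconnected (g := fun k z => connTerm q μ z k)
    (g' := fun k z => -connTerm q (μ + 1) z k) hu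
    ((isOpen_lt continuous_const Complex.continuous_re).inter Metric.isOpen_ball)
    ((convex_halfSpace_re_gt _).inter (convex_ball _ _)).isPreconnected
    (fun k z hz => hasDerivAt_connTerm h0 h1 (hk k) (mem_slitPlane_of_re_pos ?_))
    (fun k z hz => ?_) hxm (h.summable hx) hxm
  · exact (half_pos hx).trans hz.1
  · rw [norm_neg]
    exact hb z (hsub z hz) k

theorem tsum_connTerm_sub_scale {q : ℝ} (h0 : 0 < q) (h1 : q < 1) {μ : ℂ}
    (hk : ∀ k, muK q μ k ≠ 0) (h : ConnNormal q μ) {x : ℂ} (hx : 0 < x.re) :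
    ∑' k, connTerm q μ x k - (q : ℂ) ^ μ * ∑' k, connTerm q μ (q * x) k
      = ∑' k, connTerm q (μ + 1) x k := by
  have hqx : 0 < ((q : ℂ) * x).re := by
    rw [Complex.re_ofReal_mul]
    exact mul_pos h0 hx
  rw [← tsum_mul_left, ← (h.summable hx).tsum_sub ((h.summable hqx).mul_left _)]
  exact tsum_congr fun k =>
    connTerm_sub_scale h0 h1 (hk k) (Complex.slitPlane_ne_zero (mem_slitPlane_of_re_pos hx))

/-- The constant in the connection formula. -/
def connConst (q : ℝ) (μ : ℂ) : ℂ :=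
  kappa q * qPochInf ((q : ℂ) ^ μ) q / (2 * Real.pi * qPochInf (q : ℂ) q)

theorem connConst_eq {q : ℝ} (h0 : 0 < q) (h1 : q < 1) (μ : ℂ) :
    connConst q μ = (1 - (q : ℂ) ^ μ) * connConst q (μ + 1) := by
  rw [connConst, connConst, qPochInf_succ h0 h1, qpow_add_one h0]
  ring

/-- The difference `D` of the two sides of the connection formula has zero derivative and satisfies
`D(x) = q^μ D(qx)` with `q^μ ≠ 1`, so it vanishes. -/
theorem F_eq_tsum_connTerm_of_add_one {q : ℝ} (h0 : 0 < q) (h1 : q < 1) {μ : ℂ}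
    (hμ : (q : ℂ) ^ μ ≠ 1) (hk : ∀ k, muK q μ k ≠ 0) (h : ConnNormal q μ)
    (h' : ConnNormal q (μ + 1))
    (hF : ∀ x : ℂ, 0 < x.re → F (μ + 1) q x = connConst q (μ + 1) * ∑' k, connTerm q (μ + 1) x k)
    {x : ℂ} (hx : 0 < x.re) : F μ q x = connConst q μ * ∑' k, connTerm q μ x k := by
  set D : ℂ → ℂ := fun z => F μ q z - connConst q μ * ∑' k, connTerm q μ z k with hD
  have hderiv : ∀ z : ℂ, 0 < z.re → HasDerivAt D 0 z := fun z hz => by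
    refine ((hasDerivAt_F_shift h0 h1 μ z).sub
      ((hasDerivAt_tsum_connTerm h0 h1 hk h h' hz).const_mul _)).congr_deriv ?_
    rw [hF z hz, connConst_eq h0 h1 μ]
    ring
  have hqx : 0 < ((q : ℂ) * x).re := by
    rw [Complex.re_ofReal_mul]
    exact mul_pos h0 hx
  have hconst : D (q * x) = D x := by
    have hs : Convex ℝ {z : ℂ | 0 < z.re} := convex_halfSpace_re_gt 0
    have hm := hs.norm_image_sub_le_of_norm_hasDerivWithin_le (f := D) (f' := fun _ => 0) (C := 0)
      (fun z hz => (hderiv z hz).hasDerivWithinAt) (fun _ _ => by simp) hx hqx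
    rw [zero_mul] at hm
    exact sub_eq_zero.mp (norm_le_zero_iff.mp hm)
  have hscale : D x = (q : ℂ) ^ μ * D (q * x) := by
    have e1 := F_sub_F_scale h0 h1 μ x
    have e2 := tsum_connTerm_sub_scale h0 h1 hk h hx
    rw [hF x hx] at e1
    have e3 := connConst_eq h0 h1 μ
    simp only [hD]
    linear_combination e1 - connConst q μ * e2 - (∑' k, connTerm q (μ + 1) x k) * e3
  rw [hconst] at hscale
  have hzero : (1 - (q : ℂ) ^ μ) * D x = 0 := by linear_combination hscale
  have := (mul_eq_zero.mp hzero).resolve_left (sub_ne_zero.mpr (Ne.symm hμ))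
  exact sub_eq_zero.mp this

/-! ### Induction over the half-planes `Re μ > -N` -/

theorem qpow_ne_one {q : ℝ} (h0 : 0 < q) (h1 : q < 1) {μ : ℂ} (hk : ∀ k, muK q μ k ≠ 0) :
    (q : ℂ) ^ μ ≠ 1 := by
  have hq : (q : ℂ) ≠ 0 := by exact_mod_cast h0.ne'
  have hl : (Real.log q : ℂ) ≠ 0 := by exact_mod_cast (Real.log_neg h0 h1).ne
  rw [Complex.cpow_def_of_ne_zero hq, ← Complex.ofReal_log h0.le]
  intro h
  obtain ⟨n, hn⟩ := Complex.exp_eq_one_iff.mp h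
  refine hk n ?_
  rw [muK, kappa]
  push_cast
  field_simp
  linear_combination hn

/-- The nonvanishing of all `μ_k + m` passes from `μ` to `μ+1`, and its case `m = 0` is what one
descent step needs. Normal convergence is carried along because termwise differentiation requires it
at `μ+1`. -/
theorem connection_formula {q : ℝ} (h0 : 0 < q) (h1 : q < 1) (N : ℕ) :
    ∀ μ : ℂ, -(N : ℝ) < μ.re → (∀ (m : ℕ) (k : ℤ), muK q (μ + m) k ≠ 0) →
      ConnNormal q μ ∧
        ∀ x : ℂ, 0 < x.re → F μ q x = connConst q μ * ∑' k, connTerm q μ x k := by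
  induction N with
  | zero =>
    intro μ hμ _
    have hμ : 0 < μ.re := by simpa using hμ
    exact ⟨connNormal_of_re_pos h0 h1 hμ, fun x hx => F_eq_tsum_connTerm_of_re_pos h0 h1 hμ hx⟩
  | succ N ih =>
    intro μ hμ hne
    have hk : ∀ k, muK q μ k ≠ 0 := by simpa using hne 0
    have hq := qpow_ne_one h0 h1 hk
    obtain ⟨h', hF⟩ := ih (μ + 1) (by push_cast at hμ; simp only [Complex.add_re, Complex.one_re]; linarith)
      (fun m k => by simpa [add_assoc, add_comm (1 : ℂ)] using hne (m + 1) k)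
    have h := h'.of_add_one h0 h1 hq hk
    exact ⟨h, fun x hx => F_eq_tsum_connTerm_of_add_one h0 h1 hq hk h h' hF hx⟩

end Pantograph

end

open Pantograph in
theorem theorem1p3 (q : ℝ) (hq0 : 0 < q) (hq1 : q < 1) (μ : ℂ) :
    -- (1) `F` solves `y'(x) = q^μ y(qx) - y(x)` on `ℂ`, and every `x^{-μ_k} G(μ_k;q,1/x)` solves it
    -- on the whole Riemann surface of the logarithm
    (∀ x : ℂ, HasDerivAt (F μ q) ((q : ℂ) ^ μ * F μ q ((q : ℂ) * x) - F μ q x) x) ∧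
    (∀ (k : ℤ) (x : LogSurface),
      LogSurface.HasDeriv (solInfinity (muK q μ k) q)
        ((q : ℂ) ^ μ * solInfinity (muK q μ k) q (x.scale q hq0)
          - solInfinity (muK q μ k) q x) x) ∧
    -- (2) the connection formula on the right half-plane
    ((∀ (m : ℕ) (l : ℤ), μ ≠ -(m : ℂ) + (kappa q : ℂ) * (l : ℂ) * Complex.I) →
      ∀ x : ℂ, 0 < x.re →
        Summable (fun k : ℤ =>
          Complex.Gamma (muK q μ k) * x ^ (-muK q μ k) * G (muK q μ k) q (1 / x)) ∧
        F μ q x = (kappa q : ℂ) * qPochInf ((q : ℂ) ^ μ) q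
            / (2 * (Real.pi : ℂ) * qPochInf (q : ℂ) q)
          * ∑' k : ℤ,
            Complex.Gamma (muK q μ k) * x ^ (-muK q μ k) * G (muK q μ k) q (1 / x)) := by
  refine ⟨hasDerivAt_F hq0 hq1 μ, hasDeriv_solInfinity hq0 hq1 μ, fun hμ x hx => ?_⟩
  obtain ⟨N, hN⟩ := exists_nat_gt (-μ.re)
  -- The index is `-k` because `μ + m + kκi = 0` means `μ = -m + κ(-k)i`.
  obtain ⟨h, hF⟩ := connection_formula hq0 hq1 N μ (by linarith) fun m k hmk => hμ m (-k) (by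
    rw [muK] at hmk
    push_cast
    linear_combination hmk)
  exact ⟨h.summable hx, hF x hx⟩
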